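/- **Setup.** A scalar tree Witten diagram is a finite tree whose nodes are the bulk vertices and whose edges are the bulk-to-bulk propagators, together with a finite set of boundary points, each attached to one bulk vertex; every bulk vertex has valency at least $3$ (propagators of both kinds counted). Boundary point $i$ has a dimension $\Delta_i\in\mathbb{C}$, and $h\in\mathbb{R}$. Mellin variables $\tau_{ij}=\tau_{ji}$ ($i\ne j$) obey $\sum_{j\neq i}\tau_{ij}=\Delta_i$. Write $B\left[{x\atop y}\right]=\Gamma(x)\Gamma(y-x)/\Gamma(y)$. *Vertex insertion.* Let the original tree diagram have boundary points $0,1,\dots,m$ with $\Delta_0=h-c$, $c\in\mathbb{C}$, and let $A_1$ be the bulk vertex to which the point $0$ is attached. A new vertex with boundary points $A_0=\{m+1,\dots,n\}$, $n-m\ge 2$, is joined to $A_1$ by a new propagator with spectrum variable $c_{(1)}=c$, replacing point $0$. For $\delta_{ij}$ satisfying the constraints of the new diagram (points $1,\dots,n$), vertex insertion takes a function $M_0[\tau]$ to $$M[\delta]=\int[\mathrm{d}\tau]_0\,M_0[\tau]\,K_2\prod_{1\le i<j\le m}B\left[{\tau_{ij}\atop\delta_{ij}}\right],\qquad K_2=\frac{\Gamma(\frac{\Delta_{A_0}-h+c}{2})\Gamma(\frac{\Delta_{A_0}-h-c}{2})\Gamma(\frac{h+c-s_{(1)}}{2})}{\Gamma(\frac{\Delta_{A_0}-s_{(1)}}{2})},$$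 with $\Delta_{A_0}=\sum_{i\in A_0}\Delta_i$, $s_{(1)}=\Delta_{A_0}-2\sum_{i<j\in A_0}\delta_{ij}$, and $[\mathrm{d}\tau]_0$ the product of $\frac{\mathrm{d}\tau_{ij}}{2\pi i}$ over all $1\le i<j\le m$ but one (an arbitrary one), the other $\tau$'s being solved for. The contours are vertical lines $\mathrm{Re}\,\tau_{ij}=\rho_{ij}$, oriented upwards, where $\rho$ satisfies the constraints with $\mathrm{Re}\,\Delta_i$ and $0<\rho_{ij}<\mathrm{Re}\,\delta_{ij}$ for $1\le i<j\le m$. *Tree pre-amplitudes.* The pre-amplitude of a contact diagram (at least three points) is $\Gamma(\frac{1}{2}\sum_i\Delta_i-h)$; that of a general tree diagram arises by successive vertex insertions, each on vertical contours as above. It is considered at those $\tau$ whose real parts are compatible with these contours: at each insertion step, in the notation above, $\mathrm{Re}\,\delta_{ij}>\rho_{ij}$ for $1\le i<j\le m$ and $\mathrm{Re}\,s_{(1)}<\mathrm{Re}(h+c)$. *Mandelstam variables.* Root the original tree at $A_1$. For a bulk vertex $a$ let $(a)$ be the propagator that joins it to its parent, where $(1)$ is the new propagator, and let $(a,m)$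 be the propagators to its children. Let $A_{(a)}\subseteq\{1,\dots,m\}$ be the set of points attached to $a$ or to its descendants, $\Delta_{A_a}$ the sum of $\Delta_i$ over the points $i\neq 0$ attached to $a$ itself, and $$\Xi_{(a)}=\sum_{i\in A_{(a)}}\Delta_i-2\sum_{i<j\in A_{(a)}}\tau_{ij},\qquad s_{(a)}=\sum_{i\in A_{(a)}}\Delta_i-2\sum_{i<j\in A_{(a)}}\delta_{ij}.$$ Then $\Xi_{(1)}=h-c$ is fixed; the other $\Xi_{(a)}$, one for each propagator of the original tree, are the Mandelstam variables $\Xi$ of $M_0$, and $\sharp[\Xi]$ is their number. **Claim.** Let $M_0$ be a tree pre-amplitude of the original diagram, and let $\rho$ be compatible with its contours. Then $M_0$ depends on $\tau$ only through $\Xi$, the insertion integral converges absolutely, and $$M[s]=\frac{1}{(-2)^{\sharp[\Xi]}}\int[\mathrm{d}\Xi]\,M_0[\Xi]\,K[\Xi,s],\qquad K=K_2\prod_{a\in\{\text{original vertices}\}}B\left[{\frac{\Delta_{A_a}-\Xi_{(a)}+\sum_m\Xi_{(a,m)}}{2}\atop\frac{\Delta_{A_a}-s_{(a)}+\sum_m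 s_{(a,m)}}{2}}\right],$$ where $[\mathrm{d}\Xi]=\prod\frac{\mathrm{d}\Xi_{(a)}}{2\pi i}$, the integral over $\Xi$ converges absolutely, and each $\Xi_{(a)}$ runs over the vertical line that is the image of the $\tau$ contour, with the orientation induced by $\Xi_{(a)}=\cdots-2\sum\tau_{ij}$, i.e. from $+i\infty$ to $-i\infty$. The same formula, with an absolutely convergent right-hand side, holds for every function $M_0$ that on the $\tau$ contour depends on $\tau$ only through $\Xi$ and for which the insertion integral converges absolutely. -/

import Mathlib

/-!
Mellin pre-amplitudes of scalar tree Witten diagrams, and the insertion of a bulk vertex.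

A tree diagram is a finite tree `G` on its bulk vertices `V` (the edges are the bulk-to-bulk
propagators) with a finite set `N` of boundary points and a map `att : N → V` telling to which
bulk vertex each boundary point is attached.
-/

namespace Witten

open Complex

/-- Unordered pairs of distinct elements, the index set of the Mellin variables. -/
abbrev Pr (N : Type) : Type := {e : Sym2 N // ¬ e.IsDiag}

/-- All elements except `a`. -/
abbrev Rest {α : Type} (a : α) : Type := {x : α // x ≠ a}

noncomputable instance {N : Type} [Finite N] : Fintype (Pr N) := Fintype.ofFinite _

noncomputable instance {α : Type} [Finite α] (a : α) : Fintype (Rest a) := Fintype.ofFinite _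

/-- The pair of the images of the two elements of a pair under an injection. -/
def Pr.map {N N' : Type} (f : N ↪ N') (e : Pr N) : Pr N' :=
  ⟨e.1.map f, fun h => e.2 ((Sym2.isDiag_map f.injective).1 h)⟩

/-- A pair that does not contain `i₀`, as a pair of elements different from `i₀`. -/
def Pr.restrict {N : Type} {i₀ : N} (e : Pr N) (h : i₀ ∉ e.1) : Pr (Rest i₀) :=
  ⟨e.1.attachWith (P := fun i => i ≠ i₀) (fun _ hi hii => h (hii ▸ hi)), fun hd => e.2 (by
    have h2 := hd.map (f := Subtype.val)
    simpa using h2)⟩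

section Combinatorics

variable {V N : Type}

/-- The vertices of the subtree that hangs at `a`, in the tree `G` rooted at `r`:
those `v` for which the path from `r` to `v` passes through `a`. -/
def branch (G : SimpleGraph V) (r a : V) : Set V := {v | G.dist r v = G.dist r a + G.dist a v}

/-- The vertices that immediately descend from `a`, in the tree `G` rooted at `r`. -/
def children (G : SimpleGraph V) (r a : V) : Set V := {b | G.Adj a b ∧ G.dist r b = G.dist r a + 1}

/-- The number of propagators of both kinds that end at the bulk vertex `v`. -/
noncomputable def valency (G : SimpleGraph V) (att : N → V) (v : V) : ℕ :=
  (G.neighborSet v).ncard + {i | att i = v}.ncard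

/-- The tree `G` with one more vertex `none`, joined to `r`. -/
def insertGraph (G : SimpleGraph V) (r : V) : SimpleGraph (Option V) :=
  G.map Function.Embedding.some ⊔ SimpleGraph.edge none (some r)

/-- After a vertex insertion at the boundary point `i₀`, the boundary points are the old ones
except `i₀`, attached as before, and those of the new vertex `none`. -/
def insertAtt (att : N → V) (i₀ : N) (A₀ : Type) : Rest i₀ ⊕ A₀ → Option V :=
  Sum.elim (fun k => some (att k.1)) (fun _ => none)

/-- The dimensions of the boundary points after a vertex insertion at `i₀`. -/
def insertDim {R : Type} {i₀ : N} {A₀ : Type} (Δ : N → R) (Δ' : A₀ → R) : Rest i₀ ⊕ A₀ → R :=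
  Sum.elim (fun k => Δ k.1) Δ'

/-- The boundary points on the far side of the propagator that leads from `a` towards the
boundary point `i₀`, in the diagram before the insertion. -/
def oldCut (G : SimpleGraph V) (att : N → V) (i₀ : N) (a : V) : Set N :=
  {k | k ≠ i₀ ∧ att k ∈ branch G (att i₀) a}

/-- The same set of boundary points, in the diagram after the insertion at `i₀`. -/
def newCut (G : SimpleGraph V) (att : N → V) (i₀ : N) (A₀ : Type) (a : V) : Set (Rest i₀ ⊕ A₀) :=
  {x | ∃ v ∈ branch G (att i₀) a, insertAtt att i₀ A₀ x = some v}

end Combinatorics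

section MellinVariables

variable {N : Type} [Fintype N] {R : Type} [CommRing R]

open scoped Classical in
/-- The canonical constraints on Mellin variables: `∑_{j ≠ i} τ_{ij} = Δ_i` for all `i`. -/
def Canonical (Δ : N → R) (τ : Pr N → R) : Prop :=
  ∀ i, ∑ e : Pr N with i ∈ e.1, τ e = Δ i

open scoped Classical in
/-- The Mandelstam variable of a set `S` of boundary points:
`∑_{i ∈ S} Δ_i - 2 ∑_{i<j ∈ S} τ_{ij}`. -/
noncomputable def mandelstam (Δ : N → R) (τ : Pr N → R) (S : Set N) : R :=
  ∑ i with i ∈ S, Δ i - 2 * ∑ e : Pr N with ∀ i ∈ e.1, i ∈ S, τ e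

end MellinVariables

section Contours

variable {ι : Type} [Fintype ι]

/-- The point with parameter `y` on the product of the vertical lines through `x k`; the lines run
upwards for `ε = 1` and downwards for `ε = -1`. -/
noncomputable def line (ε : ℝ) (x y : ι → ℝ) : ι → ℂ := fun k => x k + ε * y k * I

/-- `∫ ∏_k dz_k / (2πi) f(z)` along the vertical lines through `x k`, all of them oriented from
`-i∞` to `+i∞` for `ε = 1` and from `+i∞` to `-i∞` for `ε = -1`. -/
noncomputable def mellinIntegral (ε : ℝ) (x : ι → ℝ) (f : (ι → ℂ) → ℂ) : ℂ :=
  (ε / (2 * Real.pi)) ^ Fintype.card ι * ∫ y : ι → ℝ, f (line ε x y)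

/-- The Mellin integral converges absolutely. -/
def MellinConverges (ε : ℝ) (x : ι → ℝ) (f : (ι → ℂ) → ℂ) : Prop :=
  MeasureTheory.Integrable (fun y : ι → ℝ => f (line ε x y))

end Contours

/-- `B[x; y] = Γ(x) Γ(y - x) / Γ(y)`. -/
noncomputable def B (x y : ℂ) : ℂ := Gamma x * Gamma (y - x) / Gamma y

/-- The factor `K₂`, where `D` is the total dimension of the boundary points of the inserted
vertex and `s` the Mandelstam variable of the new propagator. -/
noncomputable def K₂ (h : ℝ) (c D s : ℂ) : ℂ :=
  Gamma ((D - h + c) / 2) * Gamma ((D - h - c) / 2) * Gamma ((h + c - s) / 2) / Gamma ((D - s) / 2)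

section VertexInsertion

variable {N A₀ : Type} [Fintype N] [Fintype A₀] {i₀ : N}

open scoped Classical in
/-- The Mellin variables `τ_{ij}`, `i, j ≠ i₀`, in terms of the independent ones, which are all of
these except `τ_{e₀}`. The latter is solved for by
`∑_{i<j; i,j ≠ i₀} τ_{ij} = (∑_{k ≠ i₀} Δ_k - Δ_{i₀}) / 2`. -/
noncomputable def solveInner (Δ : N → ℂ) (e₀ : Pr (Rest i₀)) (z : Rest e₀ → ℂ) :
    Pr (Rest i₀) → ℂ := fun e =>
  if he : e = e₀ then (∑ k : Rest i₀, Δ k.1 - Δ i₀) / 2 - ∑ f, z f else z ⟨e, he⟩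

open scoped Classical in
/-- All Mellin variables in terms of the independent ones; for the remaining ones,
`τ_{i₀k} = Δ_k - ∑_{j ≠ i₀, k} τ_{kj}`. -/
noncomputable def solve (Δ : N → ℂ) (e₀ : Pr (Rest i₀)) (z : Rest e₀ → ℂ) : Pr N → ℂ := fun e =>
  if he : i₀ ∈ e.1 then
    Δ (Sym2.Mem.other he) -
      ∑ f : Pr (Rest i₀) with Sym2.Mem.other he ∈ (f.map (Function.Embedding.subtype _)).1,
        solveInner Δ e₀ z f
  else solveInner Δ e₀ z (e.restrict he)

/-- The kernel `K_pre[τ, δ]` of vertex insertion at `i₀`. The dimension of `i₀` is `h - c`; the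
inserted vertex carries the boundary points `A₀`, of dimensions `Δ'`, besides one of dimension
`h + c` that is glued to `i₀`. -/
noncomputable def preKernel (h : ℝ) (c : ℂ) (Δ : N → ℂ) (Δ' : A₀ → ℂ)
    (τ : Pr N → ℂ) (δ : Pr (Rest i₀ ⊕ A₀) → ℂ) : ℂ :=
  K₂ h c (∑ i, Δ' i) (mandelstam (insertDim Δ Δ') δ (Set.range Sum.inr)) *
    ∏ e : Pr (Rest i₀), B (τ (e.map (Function.Embedding.subtype _))) (δ (e.map .inl))

/-- The integrand `M₀[τ] K_pre[τ, δ]` as a function of the independent Mellin variables. -/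
noncomputable def insertionIntegrand (h : ℝ) (c : ℂ) (Δ : N → ℂ) (Δ' : A₀ → ℂ)
    (e₀ : Pr (Rest i₀)) (M₀ : (Pr N → ℂ) → ℂ) (δ : Pr (Rest i₀ ⊕ A₀) → ℂ) : (Rest e₀ → ℂ) → ℂ :=
  fun z => M₀ (solve Δ e₀ z) * preKernel h c Δ Δ' (solve Δ e₀ z) δ

/-- The real parts of the independent Mellin variables on the contour `Re τ = ρ`. -/
def insertionBase (e₀ : Pr (Rest i₀)) (ρ : Pr N → ℝ) : Rest e₀ → ℝ :=
  fun e => ρ (e.1.map (Function.Embedding.subtype _))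

/-- Vertex insertion: `M[δ] = ∫ [dτ]₀ M₀[τ] K_pre[τ, δ]`, on the contour `Re τ = ρ`. -/
noncomputable def vertexInsertion (h : ℝ) (c : ℂ) (Δ : N → ℂ) (Δ' : A₀ → ℂ)
    (e₀ : Pr (Rest i₀)) (ρ : Pr N → ℝ) (M₀ : (Pr N → ℂ) → ℂ) (δ : Pr (Rest i₀ ⊕ A₀) → ℂ) : ℂ :=
  mellinIntegral 1 (insertionBase e₀ ρ) (insertionIntegrand h c Δ Δ' e₀ M₀ δ)

end VertexInsertion

/-- `IsTreePreAmplitude h G att Δ U M`: the function `M` of the Mellin variables is the pre-amplitude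
of the tree diagram `(G, att)` with boundary dimensions `Δ` (for some values of the spectrum
variables `c` of its propagators), built from a contact diagram by successive vertex insertions.
`U` is the set of those real parts of the Mellin variables at which all contours in this
construction separate the left from the right poles. -/
inductive IsTreePreAmplitude (h : ℝ) : ∀ {V N : Type} [Fintype V] [Fintype N],
    SimpleGraph V → (N → V) → (N → ℂ) → Set (Pr N → ℝ) → ((Pr N → ℂ) → ℂ) → Prop
  /-- A contact diagram: `M = Γ(∑ Δ_i / 2 - h)`. -/
  | contact {N : Type} [Fintype N] (Δ : N → ℂ) (hN : 3 ≤ Fintype.card N) :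
      IsTreePreAmplitude h (⊥ : SimpleGraph Unit) (fun _ : N => ()) Δ Set.univ
        (fun _ => Gamma ((∑ i, Δ i) / 2 - h))
  /-- Insertion of a vertex at the boundary point `i₀`, on a contour `Re τ = ρ`. -/
  | insert {V N A₀ : Type} [Fintype V] [Fintype N] [Fintype A₀]
      {G : SimpleGraph V} {att : N → V} {Δ : N → ℂ} {U : Set (Pr N → ℝ)} {M : (Pr N → ℂ) → ℂ}
      (hM : IsTreePreAmplitude h G att Δ U M)
      (i₀ : N) (c : ℂ) (hc : Δ i₀ = h - c) (Δ' : A₀ → ℂ) (hA₀ : 2 ≤ Fintype.card A₀)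
      (e₀ : Pr (Rest i₀)) (ρ : Pr N → ℝ) (hρ : Canonical (fun i => (Δ i).re) ρ) (hU : ρ ∈ U)
      (hpos : ∀ e : Pr (Rest i₀), 0 < ρ (e.map (Function.Embedding.subtype _))) :
      IsTreePreAmplitude h (insertGraph G (att i₀)) (insertAtt att i₀ A₀) (insertDim Δ Δ')
        {σ | (∀ e : Pr (Rest i₀), ρ (e.map (Function.Embedding.subtype _)) < σ (e.map .inl)) ∧
          mandelstam (fun x => (insertDim Δ Δ' x).re) σ (Set.range Sum.inr) < h + c.re}
        (vertexInsertion h c Δ Δ' e₀ ρ M)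

section TreeKernel

variable {V N : Type} [Fintype V] [Fintype N]

open scoped Classical in
/-- The Mandelstam variables of all `(a)`, where `(r)` stands for the new propagator, whose
Mandelstam variable in the original diagram has the fixed value `Ξ_r`. -/
noncomputable def extendXi {r : V} (Ξr : ℂ) (Ξ : Rest r → ℂ) : V → ℂ := fun a =>
  if ha : a = r then Ξr else Ξ ⟨a, ha⟩

open scoped Classical in
/-- `Δ_{A_a}`, the total dimension of the boundary points attached to `a`, not counting `i₀`. -/
noncomputable def vertexDim (att : N → V) (Δ : N → ℂ) (i₀ : N) (a : V) : ℂ :=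
  ∑ k with k ≠ i₀ ∧ att k = a, Δ k

open scoped Classical in
/-- The kernel `K[Ξ, s]`: the product of `K₂` and of one Beta function for each original vertex.
Here `D₀ = Δ_{A₀}`. -/
noncomputable def treeKernel (h : ℝ) (c : ℂ) (G : SimpleGraph V) (att : N → V) (Δ : N → ℂ) (i₀ : N)
    (D₀ : ℂ) (Ξ : Rest (att i₀) → ℂ) (s : V → ℂ) : ℂ :=
  K₂ h c D₀ (s (att i₀)) *
    ∏ a, B ((vertexDim att Δ i₀ a - extendXi (h - c) Ξ a
              + ∑ b with b ∈ children G (att i₀) a, extendXi (h - c) Ξ b) / 2)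
           ((vertexDim att Δ i₀ a - s a + ∑ b with b ∈ children G (att i₀) a, s b) / 2)

end TreeKernel

end Witten

/-! Root the original tree at the vertex of `i₀` and assign to each pair of points other than `i₀`
its `meet`, the deepest vertex whose branch contains both. A Mandelstam variable `Ξ_(a)` is a
constant minus twice the sum of the `τ` whose meet lies in the branch at `a`. Hence `M₀` sees only
the totals of `τ` over the blocks of pairs with a common meet, and those totals are the first
arguments of the Beta functions in `K`. What remains is to integrate `∏ B[τ; δ]` at fixed block
totals.

That integral is Barnes' first lemma: `B` is the Fourier transform of a density whose parameters add
under multiplication, so convolving two `B`'s gives `B` at the sums of the arguments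
(`integral_B_mul_B`, iterated in `integral_prod_B`). To use it, one pair is singled out in each
block, which is possible because valency at least 3 makes every block nonempty (`exists_meet_eq`).
The remaining pairs together with the branch sums are new coordinates. They are related to the old
ones by affine maps with integer coefficients in both directions, so Lebesgue measure is preserved
(`measurePreserving_of_isIntAffine`). This gives `integral_hyperplane_eq`, and, after rescaling from
branch sums to Mandelstam variables, `vertexInsertion_eq`, valid for any absolutely convergent
integrand.

For tree pre-amplitudes two facts are proved by induction over insertions. First, they grow at most
polynomially along the allowed vertical directions, whereas `B` decays faster than any power of its
first argument (`exists_norm_B_le_pow`), so every insertion integral converges absolutely. Second,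
they depend on Mandelstam variables only: the formula itself exhibits the result of an insertion as
a function of `s`, so it drives the induction (`dependsOnMandelstam_of_isTreePreAmplitude`). -/

namespace Witten

open Complex MeasureTheory

/-! ### The function `B`: Fourier representation, decay, and Barnes' first lemma. -/

section BetaFunction

open scoped FourierTransform

/-- The integrand of Euler's integral for `B x y`, in the coordinate in which the domain of
integration is the real line. -/
noncomputable def betaDensity (x y : ℂ) (u : ℝ) : ℂ :=
  (Real.sigmoid u : ℂ) ^ x * ((1 - Real.sigmoid u : ℝ) : ℂ) ^ (y - x)

lemma one_sub_sigmoid_pos (u : ℝ) : 0 < 1 - Real.sigmoid u := sub_pos.2 (Real.sigmoid_lt_one u)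

lemma continuous_betaDensity (x y : ℂ) : Continuous (betaDensity x y) := by
  unfold betaDensity
  refine Continuous.mul ?_ ?_
  · refine Continuous.cpow (continuous_ofReal.comp continuous_sigmoid) continuous_const ?_
    exact fun u => ofReal_mem_slitPlane.2 (Real.sigmoid_pos u)
  · refine Continuous.cpow (continuous_ofReal.comp (continuous_const.sub continuous_sigmoid))
      continuous_const ?_
    exact fun u => ofReal_mem_slitPlane.2 (one_sub_sigmoid_pos u)

lemma norm_betaDensity (x y : ℂ) (u : ℝ) :
    ‖betaDensity x y u‖ = ‖betaDensity (x.re : ℂ) (y.re : ℂ) u‖ := by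
  unfold betaDensity
  rw [norm_mul, norm_mul, norm_cpow_eq_rpow_re_of_pos (Real.sigmoid_pos u),
    norm_cpow_eq_rpow_re_of_pos (one_sub_sigmoid_pos u),
    norm_cpow_eq_rpow_re_of_pos (Real.sigmoid_pos u),
    norm_cpow_eq_rpow_re_of_pos (one_sub_sigmoid_pos u)]
  simp

lemma betaDensity_mul (x₁ y₁ x₂ y₂ : ℂ) (u : ℝ) :
    betaDensity x₁ y₁ u * betaDensity x₂ y₂ u = betaDensity (x₁ + x₂) (y₁ + y₂) u := by
  have h1 : (Real.sigmoid u : ℂ) ≠ 0 := ofReal_ne_zero.2 (Real.sigmoid_pos u).ne'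
  have h2 : ((1 - Real.sigmoid u : ℝ) : ℂ) ≠ 0 := ofReal_ne_zero.2 (one_sub_sigmoid_pos u).ne'
  unfold betaDensity
  rw [cpow_add _ _ h1, show y₁ + y₂ - (x₁ + x₂) = (y₁ - x₁) + (y₂ - x₂) by ring, cpow_add _ _ h2]
  ring

/-- The logit of `sigmoid u` is `u`, so an imaginary shift of `x` is a character in `u`. This makes
`B`, along a vertical line in `x`, a Fourier transform. -/
lemma betaDensity_add_mul_I (x y : ℂ) (q u : ℝ) :
    betaDensity (x + q * I) y u = Complex.exp (u * q * I) * betaDensity x y u := by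
  have h1 : (Real.sigmoid u : ℂ) ≠ 0 := ofReal_ne_zero.2 (Real.sigmoid_pos u).ne'
  have h2 : ((1 - Real.sigmoid u : ℝ) : ℂ) ≠ 0 := ofReal_ne_zero.2 (one_sub_sigmoid_pos u).ne'
  have h3 : Real.log (Real.sigmoid u) - Real.log (1 - Real.sigmoid u) = u := by
    rw [← Real.sigmoid_neg, ← Real.sigmoid_mul_rexp_neg, Real.log_mul (Real.sigmoid_pos u).ne'
      (Real.exp_pos _).ne', Real.log_exp]
    ring
  unfold betaDensity
  rw [cpow_add _ _ h1, show y - (x + q * I) = (y - x) + (-(q * I)) by ring, cpow_add _ _ h2,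
    cpow_def_of_ne_zero h1 (q * I), cpow_def_of_ne_zero h2 (-(q * I)), ← ofReal_log
      (Real.sigmoid_pos u).le, ← ofReal_log (one_sub_sigmoid_pos u).le]
  have h4 : Complex.exp (u * q * I) =
      Complex.exp (Real.log (Real.sigmoid u) * (q * I)) *
        Complex.exp (Real.log (1 - Real.sigmoid u) * -(q * I)) := by
    rw [← Complex.exp_add]
    congr 1
    nth_rewrite 1 [← h3]
    push_cast
    ring
  rw [h4]
  ring

/-- Substitute `t = sigmoid u` in Euler's integral: `dt = t (1 - t) du` absorbs the two exponents
`-1`. -/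
lemma integrable_betaDensity {x y : ℂ} (hx : 0 < x.re) (hxy : x.re < y.re) :
    Integrable (betaDensity x y) ∧ ∫ u, betaDensity x y u = B x y := by
  have hv : 0 < (y - x).re := by simpa using hxy
  have hconv := betaIntegral_convergent hx hv
  rw [intervalIntegrable_iff_integrableOn_Ioo_of_le zero_le_one] at hconv
  have hval : betaIntegral x (y - x) = B x y := by
    rw [betaIntegral_eq_Gamma_mul_div _ _ hx hv, B]
    simp
  rw [betaIntegral, intervalIntegral.integral_of_le zero_le_one, integral_Ioc_eq_integral_Ioo]
    at hval
  have himg : Real.sigmoid '' Set.univ = Set.Ioo 0 1 := by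
    rw [Set.image_univ, Real.range_sigmoid]
  have hd : ∀ u ∈ (Set.univ : Set ℝ), HasDerivWithinAt Real.sigmoid
      (Real.sigmoid u * (1 - Real.sigmoid u)) Set.univ u :=
    fun u _ => (Real.hasDerivAt_sigmoid u).hasDerivWithinAt
  have heq : ∀ u : ℝ, |Real.sigmoid u * (1 - Real.sigmoid u)| •
      ((Real.sigmoid u : ℂ) ^ (x - 1) * (1 - (Real.sigmoid u : ℂ)) ^ (y - x - 1)) =
      betaDensity x y u := by
    intro u
    have h1 : (Real.sigmoid u : ℂ) ≠ 0 := ofReal_ne_zero.2 (Real.sigmoid_pos u).ne'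
    have h2 : (1 - (Real.sigmoid u : ℂ)) ≠ 0 := by
      have := (ofReal_ne_zero (z := 1 - Real.sigmoid u)).2 (one_sub_sigmoid_pos u).ne'
      simpa using this
    rw [abs_of_pos (mul_pos (Real.sigmoid_pos u) (one_sub_sigmoid_pos u)), betaDensity,
      real_smul, cpow_sub _ _ h1, cpow_sub _ _ h2]
    push_cast
    rw [cpow_one, cpow_one]
    field_simp
  have hinj := Real.sigmoid_injective.injOn (s := Set.univ)
  constructor
  · rw [← himg, integrableOn_image_iff_integrableOn_abs_deriv_smul MeasurableSet.univ hd hinj]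
      at hconv
    simp only [heq] at hconv
    rwa [integrableOn_univ] at hconv
  · rw [← himg, integral_image_eq_integral_abs_deriv_smul MeasurableSet.univ hd hinj] at hval
    simp only [heq] at hval
    rwa [setIntegral_univ] at hval

/-- The modulus of the density depends only on the real parts, and so does the bound from Euler's
integral. -/
lemma exists_norm_B_le (ρ d : ℝ) (hρ : 0 < ρ) (hd : ρ < d) :
    ∃ C : ℝ, 0 ≤ C ∧ ∀ x y : ℂ, x.re = ρ → y.re = d → ‖B x y‖ ≤ C := by
  refine ⟨∫ u, ‖betaDensity (ρ : ℂ) (d : ℂ) u‖, integral_nonneg fun _ => norm_nonneg _, ?_⟩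
  intro x y hx hy
  rw [← (integrable_betaDensity (x := x) (y := y) (by linarith) (by linarith)).2]
  refine (norm_integral_le_integral_norm _).trans_eq ?_
  congr 1
  ext u
  rw [norm_betaDensity, hx, hy]

lemma B_eq_div_mul {x y : ℂ} (hx : 0 < x.re) (hy : 0 < y.re) :
    B x y = y / x * B (x + 1) (y + 1) := by
  have hx0 : x ≠ 0 := fun h => by simp [h] at hx
  have hy0 : y ≠ 0 := fun h => by simp [h] at hy
  have hG : Gamma y ≠ 0 := Gamma_ne_zero_of_re_pos hy
  unfold B
  rw [Gamma_add_one _ hx0, Gamma_add_one _ hy0, show y + 1 - (x + 1) = y - x by ring]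
  field_simp

/-- Each use of `B_eq_div_mul` gains a factor `y / x` and raises both real parts by one, which keeps
`0 < ρ < d`. After `k` uses the uniform bound applies. The case `k = 2` gives integrability; larger
`k` beats polynomial growth. -/
lemma exists_norm_B_le_pow (k : ℕ) : ∀ ρ d : ℝ, 0 < ρ → ρ < d →
    ∃ C : ℝ, 0 ≤ C ∧ ∀ x y : ℂ, x.re = ρ → y.re = d →
      ‖B x y‖ ≤ C * ((1 + ‖y‖) / (1 + ‖x‖)) ^ k := by
  induction k with
  | zero => simpa using exists_norm_B_le
  | succ k ih =>
    intro ρ d hρ hd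
    obtain ⟨C, hC, h⟩ := ih (ρ + 1) (d + 1) (by linarith) (by linarith)
    have hL : 0 ≤ 1 + 1 / ρ := by positivity
    have hK : 0 ≤ 2 * (1 + 1 / ρ) := by positivity
    refine ⟨C * (2 * (1 + 1 / ρ)) ^ k * (1 + 1 / ρ), by positivity, ?_⟩
    intro x y hx hy
    have hxn : ρ ≤ ‖x‖ := hx ▸ (re_le_norm x)
    have hx0 : 0 < ‖x‖ := hρ.trans_le hxn
    have hx1 : ‖x‖ ≤ ‖x + 1‖ := by
      rw [Complex.norm_def, Complex.norm_def, normSq_apply, normSq_apply]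
      apply Real.sqrt_le_sqrt
      simp only [add_re, one_re, add_im, one_im, add_zero]
      nlinarith
    -- Since `‖x‖ ≥ ρ`, the factor `1 + 1 / ρ` lets `1 + ‖x‖` replace `‖x‖` in denominators.
    have hx2 : 1 + ‖x‖ ≤ (1 + 1 / ρ) * ‖x‖ := by
      have : 1 ≤ 1 / ρ * ‖x‖ := by
        rw [one_div, ← div_eq_inv_mul, le_div_iff₀ hρ]
        linarith
      linarith
    have hy1 : 1 + ‖y + 1‖ ≤ 2 * (1 + ‖y‖) := by
      have := norm_add_le y 1
      rw [norm_one] at this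
      linarith [norm_nonneg y]
    rw [B_eq_div_mul (by linarith) (by linarith), norm_mul, norm_div]
    have h1 := h (x + 1) (y + 1) (by simp [hx]) (by simp [hy])
    have hq : (1 + ‖y + 1‖) / (1 + ‖x + 1‖) ≤ 2 * (1 + 1 / ρ) * ((1 + ‖y‖) / (1 + ‖x‖)) := by
      rw [div_le_iff₀ (by positivity), mul_assoc, div_mul_eq_mul_div, mul_div_assoc']
      rw [le_div_iff₀ (by positivity)]
      have : (1 + ‖x‖) ≤ (1 + 1 / ρ) * (1 + ‖x + 1‖) := by
        refine hx2.trans (mul_le_mul_of_nonneg_left (by linarith) hL)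
      calc (1 + ‖y + 1‖) * (1 + ‖x‖) ≤ (2 * (1 + ‖y‖)) * ((1 + 1 / ρ) * (1 + ‖x + 1‖)) := by
            gcongr
        _ = _ := by ring
    have hr : ‖y‖ / ‖x‖ ≤ (1 + 1 / ρ) * ((1 + ‖y‖) / (1 + ‖x‖)) := by
      rw [div_le_iff₀ hx0, mul_assoc, div_mul_eq_mul_div, mul_div_assoc',
        le_div_iff₀ (by positivity)]
      calc ‖y‖ * (1 + ‖x‖) ≤ (1 + ‖y‖) * ((1 + 1 / ρ) * ‖x‖) := by
            gcongr
            linarith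
        _ = _ := by ring
    set Q := (1 + ‖y‖) / (1 + ‖x‖) with hQ
    have hQ0 : 0 ≤ Q := by positivity
    calc ‖y‖ / ‖x‖ * ‖B (x + 1) (y + 1)‖
        ≤ ((1 + 1 / ρ) * Q) * (C * (2 * (1 + 1 / ρ) * Q) ^ k) := by
          gcongr
          exact h1.trans (by gcongr)
      _ = _ := by
          rw [mul_pow]
          ring

/-- The reciprocal is entire, with value 0 at the poles, where `Gamma` itself is 0 by convention. -/
lemma measurable_Gamma : Measurable Complex.Gamma := by
  have h : Measurable fun s : ℂ => ((Complex.Gamma s)⁻¹)⁻¹ :=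
    differentiable_one_div_Gamma.continuous.measurable.inv
  simpa using h

lemma measurable_B {α : Type*} [MeasurableSpace α] {f g : α → ℂ} (hf : Measurable f)
    (hg : Measurable g) : Measurable fun a => B (f a) (g a) := by
  unfold B
  exact ((measurable_Gamma.comp hf).mul (measurable_Gamma.comp (hg.sub hf))).div
    (measurable_Gamma.comp hg)

lemma integrable_inv_one_add_norm_sq (x : ℂ) :
    Integrable fun q : ℝ => ((1 + ‖x + q * I‖) ^ 2)⁻¹ := by
  have h0 : Integrable fun q : ℝ => (1 + (q + x.im) ^ 2)⁻¹ :=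
    integrable_inv_one_add_sq.comp_add_right x.im
  refine h0.mono' ?_ ?_
  · refine Measurable.aestronglyMeasurable ?_
    fun_prop
  · refine Filter.Eventually.of_forall fun q => ?_
    rw [Real.norm_of_nonneg (by positivity)]
    apply inv_anti₀ (by positivity)
    have h1 : |q + x.im| ≤ ‖x + q * I‖ := by
      have := abs_im_le_norm (x + q * I)
      simpa [add_comm] using this
    have h2 : (q + x.im) ^ 2 ≤ ‖x + q * I‖ ^ 2 := by
      rw [← sq_abs]
      gcongr
    nlinarith [norm_nonneg (x + q * I)]

lemma integrable_B {x y : ℂ} (hx : 0 < x.re) (hxy : x.re < y.re) :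
    Integrable fun q : ℝ => B (x + q * I) y := by
  obtain ⟨C, hC, h⟩ := exists_norm_B_le_pow 2 x.re y.re hx hxy
  refine ((integrable_inv_one_add_norm_sq x).const_mul (C * (1 + ‖y‖) ^ 2)).mono' ?_ ?_
  · exact (measurable_B (by fun_prop) measurable_const).aestronglyMeasurable
  · refine Filter.Eventually.of_forall fun q => (h _ y (by simp) rfl).trans_eq ?_
    rw [div_pow]
    ring

lemma fourier_betaDensity {x y : ℂ} (hx : 0 < x.re) (hxy : x.re < y.re) (w : ℝ) :
    𝓕 (betaDensity x y) w = B (x + ((-2 * Real.pi * w : ℝ) : ℂ) * I) y := by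
  rw [← (integrable_betaDensity (x := x + ((-2 * Real.pi * w : ℝ) : ℂ) * I) (y := y)
    (by simpa using hx) (by simpa using hxy)).2,
    Real.fourier_real_eq_integral_exp_smul]
  congr 1
  ext u
  rw [betaDensity_add_mul_I, smul_eq_mul]
  congr 2
  push_cast
  ring

/-- Barnes' first lemma, as a convolution formula for the functions `B`. -/
lemma integral_B_mul_B {x₁ y₁ x₂ y₂ : ℂ} (hx₁ : 0 < x₁.re) (hxy₁ : x₁.re < y₁.re)
    (hx₂ : 0 < x₂.re) (hxy₂ : x₂.re < y₂.re) :
    ∫ q : ℝ, B (x₁ + q * I) y₁ * B (x₂ - q * I) y₂ =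
      2 * Real.pi * B (x₁ + x₂) (y₁ + y₂) := by
  have hpi : (2 * Real.pi) ≠ 0 := by positivity
  have hpi' : (-2 * Real.pi) ≠ 0 := by simp [Real.pi_ne_zero]
  have hi1 := (integrable_betaDensity hx₁ hxy₁).1
  have hi2 := (integrable_betaDensity hx₂ hxy₂).1
  have hFi2 : Integrable (𝓕 (betaDensity x₂ y₂)) := by
    have h := (integrable_B hx₂ hxy₂).comp_mul_left' hpi'
    refine h.congr (Filter.Eventually.of_forall fun w => ?_)
    simp only [fourier_betaDensity hx₂ hxy₂]
  have hinv : 𝓕⁻ (𝓕 (betaDensity x₂ y₂)) = betaDensity x₂ y₂ :=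
    (continuous_betaDensity x₂ y₂).fourierInv_fourier_eq hi2 hFi2
  -- By Fourier inversion the transform of the reflected transform is the second density again. So
  -- moving `𝓕` across the pairing with `g` turns the convolution into the integral of a product of
  -- densities.
  set g : ℝ → ℂ := fun w => 𝓕 (betaDensity x₂ y₂) (-w) with hg
  have hgi : Integrable g := hFi2.comp_neg
  have hFg : 𝓕 g = betaDensity x₂ y₂ := by
    rw [← hinv]
    ext u
    rw [Real.fourier_real_eq_integral_exp_smul, Real.fourierInv_eq']
    rw [← integral_neg_eq_self]
    congr 1
    ext w
    simp only [hg, neg_neg]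
    congr 2
    simp
    ring
  have hflip : ∫ w, 𝓕 (betaDensity x₁ y₁) w * g w = ∫ u, betaDensity x₁ y₁ u * 𝓕 g u := by
    have := VectorFourier.integral_fourierIntegral_smul_eq_flip (L := innerₗ ℝ)
      (μ := volume) (ν := volume) (e := Real.fourierChar) Real.continuous_fourierChar
      (by exact continuous_inner) hi1 hgi
    simpa [Real.fourier_eq, VectorFourier.fourierIntegral, smul_eq_mul, flip_innerₗ] using this
  rw [hFg] at hflip
  simp only [betaDensity_mul, hg, fourier_betaDensity hx₁ hxy₁, fourier_betaDensity hx₂ hxy₂]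
    at hflip
  rw [(integrable_betaDensity (by simp; linarith) (by simp; linarith)).2] at hflip
  rw [← hflip]
  -- The substitution `q = -2πw` passes from frequency to Mellin variable; its Jacobian is the
  -- factor `2π` of the statement.
  have hcv := Measure.integral_comp_mul_left
    (fun q : ℝ => B (x₁ + q * I) y₁ * B (x₂ - q * I) y₂) (-2 * Real.pi)
  rw [show |(-2 * Real.pi)⁻¹| = (2 * Real.pi)⁻¹ by
    rw [abs_inv]; congr 1; rw [neg_mul, abs_neg, abs_of_pos (by positivity)]] at hcv
  have h3 : (∫ w : ℝ, B (x₁ + ((-2 * Real.pi * w : ℝ) : ℂ) * I) y₁ *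
      B (x₂ + ((-2 * Real.pi * -w : ℝ) : ℂ) * I) y₂) =
      ∫ w : ℝ, B (x₁ + ((-2 * Real.pi * w : ℝ) : ℂ) * I) y₁ *
        B (x₂ - ((-2 * Real.pi * w : ℝ) : ℂ) * I) y₂ := by
    congr 1
    ext w
    congr 2
    push_cast
    ring
  rw [h3, hcv, real_smul]
  have : (2 * Real.pi : ℂ) ≠ 0 := by exact_mod_cast hpi
  push_cast
  exact (mul_inv_cancel_left₀ this _).symm

end BetaFunction

/-! ### Polynomial bounds for `K₂` on vertical lines. -/

section GammaRatio

/-- For `Re w > 0` the ratio is `B z (z + w) / Γ(w)`, which is bounded. Otherwise the recurrence for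
`1 / Γ` raises `w` by one, at the price of one factor `z + w`. -/
lemma exists_norm_Gamma_ratio_le (z₀ : ℝ) (hz₀ : 0 < z₀) (k : ℕ) : ∀ w : ℂ, 0 < w.re + k →
    ∃ C : ℝ, 0 ≤ C ∧ ∀ z : ℂ, z.re = z₀ → ‖Gamma z / Gamma (z + w)‖ ≤ C * (1 + ‖z‖) ^ k := by
  induction k with
  | zero =>
    intro w hw
    have hw' : 0 < w.re := by simpa using hw
    obtain ⟨C, hC, h⟩ := exists_norm_B_le z₀ (z₀ + w.re) hz₀ (by linarith)
    have hG := Gamma_ne_zero_of_re_pos hw'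
    refine ⟨C / ‖Gamma w‖, by positivity, fun z hz => ?_⟩
    have := h z (z + w) hz (by simp [hz])
    rw [B, add_sub_cancel_left, mul_div_right_comm, norm_mul] at this
    rw [pow_zero, mul_one, le_div_iff₀ (norm_pos_iff.2 hG)]
    exact this
  | succ k ih =>
    intro w hw
    obtain ⟨C, hC, h⟩ := ih (w + 1) (by push_cast at hw; simp; linarith)
    refine ⟨C * (1 + ‖w‖), by positivity, fun z hz => ?_⟩
    have h1 := one_div_Gamma_eq_self_mul_one_div_Gamma_add_one (z + w)
    have h2 := h z hz
    rw [div_eq_mul_inv, h1]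
    calc ‖Gamma z * ((z + w) * (Gamma (z + w + 1))⁻¹)‖
        = ‖Gamma z / Gamma (z + (w + 1))‖ * ‖z + w‖ := by
          rw [← norm_mul, ← add_assoc]
          congr 1
          ring
      _ ≤ (C * (1 + ‖z‖) ^ k) * ((1 + ‖w‖) * (1 + ‖z‖)) := by
          gcongr
          have := norm_add_le z w
          nlinarith [norm_nonneg z, norm_nonneg w]
      _ = _ := by ring

lemma exists_norm_K₂_le (h : ℝ) (c D : ℂ) (s₀ : ℝ) (hs₀ : s₀ < h + c.re) :
    ∃ (C : ℝ) (k : ℕ), 0 ≤ C ∧ ∀ s : ℂ, s.re = s₀ → ‖K₂ h c D s‖ ≤ C * (1 + ‖s‖) ^ k := by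
  -- The number of unit shifts that make the real part of `w = (D - h - c) / 2` positive.
  obtain ⟨k, hk⟩ := exists_nat_gt (-(((D - h - c) / 2).re))
  obtain ⟨C, hC, hb⟩ := exists_norm_Gamma_ratio_le ((h + c.re - s₀) / 2) (by linarith) k
    ((D - h - c) / 2) (by linarith)
  refine ⟨‖Gamma ((D - h + c) / 2) * Gamma ((D - h - c) / 2)‖ * C * (1 + ‖(h : ℂ) + c‖) ^ k, k,
    by positivity, fun s hs => ?_⟩
  have h1 := hb ((h + c - s) / 2) (by simp [hs])
  rw [show (h + c - s) / 2 + (D - h - c) / 2 = (D - s) / 2 by ring] at h1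
  rw [K₂, mul_div_assoc, norm_mul]
  calc _ ≤ ‖Gamma ((D - h + c) / 2) * Gamma ((D - h - c) / 2)‖ *
        (C * ((1 + ‖(h : ℂ) + c‖) * (1 + ‖s‖)) ^ k) := by
        gcongr
        refine h1.trans ?_
        gcongr
        have h2 := norm_sub_le ((h : ℂ) + c) s
        rw [norm_div, show ‖(2 : ℂ)‖ = 2 by simp]
        nlinarith [norm_nonneg ((h : ℂ) + c), norm_nonneg s, norm_nonneg ((h : ℂ) + c - s)]
    _ = _ := by
        rw [mul_pow]
        ring

lemma measurable_K₂ (h : ℝ) (c D : ℂ) : Measurable (K₂ h c D) := by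
  unfold K₂
  exact (measurable_const.mul (measurable_Gamma.comp (by fun_prop))).div
    (measurable_Gamma.comp (by fun_prop))

end GammaRatio

end Witten

namespace Witten

open Complex MeasureTheory

/-! ### Iterated Barnes convolution over blocks. -/

section BlockIntegral

variable {Q V : Type} [Fintype Q] [Fintype V] [DecidableEq V]

/-- The first product is integrable variable by variable; the second is bounded, because its
arguments keep fixed real parts. -/
lemma integrable_prod_B (β : Q → V) (x y : Q → ℂ) (X Y : V → ℂ)
    (hx : ∀ i, 0 < (x i).re) (hxy : ∀ i, (x i).re < (y i).re)
    (hX : ∀ v, 0 < (X v).re) (hXY : ∀ v, (X v).re < (Y v).re) :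
    Integrable fun q : Q → ℝ => (∏ i, B (x i + q i * I) (y i)) *
      ∏ v, B (X v - (∑ i with β i = v, q i : ℝ) * I) (Y v) := by
  choose C hC hb using fun v => exists_norm_B_le (X v).re (Y v).re (hX v) (hXY v)
  refine Integrable.mul_bdd (c := ∏ v, C v)
    (Integrable.fintype_prod fun i => integrable_B (hx i) (hxy i)) ?_ ?_
  · exact (Finset.measurable_prod _ fun v _ => measurable_B (by fun_prop)
      measurable_const).aestronglyMeasurable
  · refine Filter.Eventually.of_forall fun q => ?_
    rw [norm_prod]
    exact Finset.prod_le_prod (fun _ _ => norm_nonneg _) fun v _ => hb v _ _ (by simp) rfl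

/-- `X v` belongs to the distinguished member of block `v`, which compensates the other variables so
that the block total stays fixed. Integrating out one variable merges its factor into the
distinguished one by `integral_B_mul_B`. -/
lemma integral_prod_B_fin (n : ℕ) : ∀ (β : Fin n → V) (x y : Fin n → ℂ) (X Y : V → ℂ),
    (∀ i, 0 < (x i).re) → (∀ i, (x i).re < (y i).re) →
    (∀ v, 0 < (X v).re) → (∀ v, (X v).re < (Y v).re) →
    ∫ q : Fin n → ℝ, (∏ i, B (x i + q i * I) (y i)) *
      ∏ v, B (X v - (∑ i with β i = v, q i : ℝ) * I) (Y v) =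
    (2 * Real.pi) ^ n * ∏ v, B (X v + ∑ i with β i = v, x i) (Y v + ∑ i with β i = v, y i) := by
  induction n with
  | zero =>
    intro β x y X Y _ _ _ _
    simp [measureReal_def, volume_pi]
  | succ n ih =>
    intro β x y X Y hx hxy hX hXY
    have hint := integrable_prod_B β x y X Y hx hxy hX hXY
    have hmp := (volume_preserving_piFinSuccAbove (fun _ : Fin (n + 1) => ℝ) 0).symm
    rw [← hmp.integrable_comp_emb (MeasurableEquiv.measurableEmbedding _)] at hint
    rw [← hmp.integral_comp']
    have hfil : ∀ {R : Type} [AddCommMonoid R] (f : Fin (n + 1) → R) (v : V),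
        ∑ i with β i = v, f i = (if β 0 = v then f 0 else 0) +
          ∑ i : Fin n with β i.succ = v, f i.succ := by
      intro R _ f v
      rw [Finset.sum_filter, Fin.sum_univ_succ, Finset.sum_filter]
    have hcons : ∀ p : ℝ × (Fin n → ℝ),
        (MeasurableEquiv.piFinSuccAbove (fun _ : Fin (n + 1) => ℝ) 0).symm p =
          (Fin.cons p.1 p.2 : Fin (n + 1) → ℝ) := by
      intro p
      simp [MeasurableEquiv.piFinSuccAbove_symm_apply, Fin.insertNthEquiv]
    simp only [Function.comp_def, hcons] at hint ⊢
    rw [Measure.volume_eq_prod] at hint ⊢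
    rw [integral_prod_symm _ hint]
    set v₀ := β 0 with hv₀
    -- The distinguished parameters after the block of the variable `0` has absorbed it.
    let X' : V → ℂ := fun v => X v + if v₀ = v then x 0 else 0
    let Y' : V → ℂ := fun v => Y v + if v₀ = v then y 0 else 0
    have hinner : ∀ q : Fin n → ℝ,
        ∫ t : ℝ, (∏ i, B (x i + (Fin.cons t q : Fin (n + 1) → ℝ) i * I) (y i)) *
          ∏ v, B (X v - (∑ i with β i = v, (Fin.cons t q : Fin (n + 1) → ℝ) i : ℝ) * I) (Y v) =
        (2 * Real.pi) * ((∏ i : Fin n, B (x i.succ + q i * I) (y i.succ)) *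
          ∏ v, B (X' v - (∑ i : Fin n with β i.succ = v, q i : ℝ) * I) (Y' v)) := by
      intro q
      have hsplit : ∀ t : ℝ, (∏ i, B (x i + (Fin.cons t q : Fin (n + 1) → ℝ) i * I) (y i)) *
          ∏ v, B (X v - (∑ i with β i = v, (Fin.cons t q : Fin (n + 1) → ℝ) i : ℝ) * I) (Y v) =
          ((∏ i : Fin n, B (x i.succ + q i * I) (y i.succ)) *
            ∏ v ∈ Finset.univ.erase v₀,
              B (X' v - (∑ i : Fin n with β i.succ = v, q i : ℝ) * I) (Y' v)) *
          (B (x 0 + t * I) (y 0) *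
            B ((X v₀ - (∑ i : Fin n with β i.succ = v₀, q i : ℝ) * I) - t * I) (Y v₀)) := by
        intro t
        rw [Fin.prod_univ_succ, ← Finset.mul_prod_erase _ _ (Finset.mem_univ v₀)]
        simp only [hfil, Fin.cons_zero, Fin.cons_succ]
        have hrest : ∏ v ∈ Finset.univ.erase v₀,
            B (X v - (((if β 0 = v then t else 0) +
              ∑ i : Fin n with β i.succ = v, q i : ℝ) : ℂ) * I) (Y v) =
            ∏ v ∈ Finset.univ.erase v₀,
              B (X' v - (∑ i : Fin n with β i.succ = v, q i : ℝ) * I) (Y' v) := by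
          refine Finset.prod_congr rfl fun v hv => ?_
          have hne : v₀ ≠ v := (Finset.ne_of_mem_erase hv).symm
          simp only [X', Y', if_neg hne, add_zero]
          rw [← hv₀, if_neg hne, zero_add]
        rw [hrest]
        simp only [if_true]
        rw [show X v₀ - ((t + ∑ i : Fin n with β i.succ = v₀, q i : ℝ) : ℂ) * I =
          (X v₀ - (∑ i : Fin n with β i.succ = v₀, q i : ℝ) * I) - t * I by push_cast; ring]
        ring
      simp only [hsplit]
      rw [integral_const_mul, integral_B_mul_B (hx 0) (hxy 0) (by simpa using hX v₀)
        (by simpa using hXY v₀), ← Finset.mul_prod_erase Finset.univ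
          (fun v => B (X' v - (∑ i : Fin n with β i.succ = v, q i : ℝ) * I) (Y' v))
          (Finset.mem_univ v₀)]
      simp only [X', Y', if_true]
      rw [show x 0 + (X v₀ - (∑ i : Fin n with β i.succ = v₀, q i : ℝ) * I) =
        X v₀ + x 0 - (∑ i : Fin n with β i.succ = v₀, q i : ℝ) * I by ring, add_comm (y 0)]
      ring
    simp only [hinner]
    rw [integral_const_mul, ih (fun i => β i.succ) (fun i => x i.succ) (fun i => y i.succ) X' Y'
      (fun i => hx _) (fun i => hxy _), pow_succ']
    · simp only [hfil, X', Y', add_assoc]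
      ring
    · intro v
      by_cases h : v₀ = v
      · simp only [X', if_pos h, add_re]
        exact add_pos (hX v) (hx 0)
      · simpa [X', if_neg h] using hX v
    · intro v
      by_cases h : v₀ = v
      · simp only [X', Y', if_pos h, add_re]
        exact add_lt_add (hXY v) (hxy 0)
      · simpa [X', Y', if_neg h] using hXY v

lemma integral_prod_B (β : Q → V) (x y : Q → ℂ) (X Y : V → ℂ)
    (hx : ∀ i, 0 < (x i).re) (hxy : ∀ i, (x i).re < (y i).re)
    (hX : ∀ v, 0 < (X v).re) (hXY : ∀ v, (X v).re < (Y v).re) :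
    ∫ q : Q → ℝ, (∏ i, B (x i + q i * I) (y i)) *
      ∏ v, B (X v - (∑ i with β i = v, q i : ℝ) * I) (Y v) =
    (2 * Real.pi) ^ Fintype.card Q *
      ∏ v, B (X v + ∑ i with β i = v, x i) (Y v + ∑ i with β i = v, y i) := by
  let e := (Fintype.equivFin Q).symm
  rw [← (volume_measurePreserving_piCongrLeft (fun _ : Q => ℝ) e).integral_comp']
  have hsum : ∀ {R : Type} [AddCommMonoid R] (f : Q → R) (v : V),
      ∑ i with β i = v, f i = ∑ j with β (e j) = v, f (e j) := by
    intro R _ f v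
    rw [Finset.sum_filter, Finset.sum_filter, ← e.sum_comp]
  simp only [hsum, ← e.prod_comp]
  simp only [MeasurableEquiv.coe_piCongrLeft, Equiv.piCongrLeft_apply_apply]
  exact integral_prod_B_fin _ (fun j => β (e j)) (fun j => x (e j)) (fun j => y (e j)) X Y
    (fun _ => hx _) (fun _ => hxy _) hX hXY

end BlockIntegral

/-! ### Unimodular affine maps preserve Lebesgue measure. -/

section IntegralAffine

/-- An affine function whose linear part has integer coefficients. -/
def IsIntAffine {ι : Type} [Fintype ι] (φ : (ι → ℝ) → ℝ) : Prop :=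
  ∃ (n : ι → ℤ) (c : ℝ), ∀ x, φ x = ∑ i, n i * x i + c

variable {ι κ : Type} [Fintype ι] [Fintype κ]

lemma IsIntAffine.const (c : ℝ) : IsIntAffine fun _ : ι → ℝ => c := ⟨0, c, by simp⟩

lemma IsIntAffine.apply (i : ι) : IsIntAffine fun x : ι → ℝ => x i := by
  classical
  exact ⟨Pi.single i 1, 0, fun x => by simp [Pi.single_apply]⟩

lemma IsIntAffine.add {φ ψ : (ι → ℝ) → ℝ} (hφ : IsIntAffine φ) (hψ : IsIntAffine ψ) :
    IsIntAffine fun x => φ x + ψ x := by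
  obtain ⟨n, c, h⟩ := hφ
  obtain ⟨m, d, h'⟩ := hψ
  refine ⟨n + m, c + d, fun x => ?_⟩
  simp only [h, h', Pi.add_apply, Int.cast_add, add_mul, Finset.sum_add_distrib]
  ring

lemma IsIntAffine.neg {φ : (ι → ℝ) → ℝ} (hφ : IsIntAffine φ) : IsIntAffine fun x => -φ x := by
  obtain ⟨n, c, h⟩ := hφ
  refine ⟨-n, -c, fun x => ?_⟩
  simp [h, add_comm]

lemma IsIntAffine.sub {φ ψ : (ι → ℝ) → ℝ} (hφ : IsIntAffine φ) (hψ : IsIntAffine ψ) :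
    IsIntAffine fun x => φ x - ψ x := by
  simpa only [sub_eq_add_neg] using hφ.add hψ.neg

lemma IsIntAffine.sum {α : Type} (s : Finset α) {φ : α → (ι → ℝ) → ℝ}
    (h : ∀ a ∈ s, IsIntAffine (φ a)) : IsIntAffine fun x => ∑ a ∈ s, φ a x := by
  classical
  induction s using Finset.induction_on with
  | empty => simpa using IsIntAffine.const 0
  | insert a s ha ih =>
    simp only [Finset.sum_insert ha]
    exact (h a (Finset.mem_insert_self a s)).add
      (ih fun b hb => h b (Finset.mem_insert_of_mem hb))

/-- An integer matrix with an integer inverse has determinant `±1`. -/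
lemma measurePreserving_toLin'_of_int [DecidableEq ι] (A A' : Matrix ι ι ℤ) (h : A * A' = 1) :
    MeasurePreserving (Matrix.toLin' (A.map (Int.cast : ℤ → ℝ))) := by
  have hu : IsUnit A.det := by
    have := congrArg Matrix.det h
    rw [Matrix.det_mul, Matrix.det_one] at this
    exact IsUnit.of_mul_eq_one _ this
  have hd : (A.map (Int.cast : ℤ → ℝ)).det = (A.det : ℝ) :=
    ((Int.castRingHom ℝ).map_det A).symm
  have habs : |(A.map (Int.cast : ℤ → ℝ)).det| = 1 := by
    rw [hd]
    rcases Int.isUnit_iff.1 hu with h1 | h1 <;> simp [h1]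
  have hne : (A.map (Int.cast : ℤ → ℝ)).det ≠ 0 := fun h0 => by simp [h0] at habs
  refine ⟨(LinearMap.continuous_of_finiteDimensional _).measurable, ?_⟩
  rw [Real.map_matrix_volume_pi_eq_smul_volume_pi hne, abs_inv, habs]
  simp

lemma mul_eq_one_of_mulVec [DecidableEq κ] (P : Matrix κ ι ℤ) (R : Matrix ι κ ℤ)
    (h : ∀ y : κ → ℝ, (P.map (Int.cast : ℤ → ℝ)).mulVec
      ((R.map (Int.cast : ℤ → ℝ)).mulVec y) = y) : P * R = 1 := by
  apply Matrix.map_injective (Int.cast_injective (α := ℝ))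
  refine (Matrix.map_mul (L := P) (M := R) (f := Int.castRingHom ℝ)).trans ?_
  refine Eq.trans ?_ (Matrix.map_one (n := κ) (Int.cast : ℤ → ℝ) (by simp) (by simp)).symm
  apply Matrix.mulVec_injective
  ext1 y
  rw [← Matrix.mulVec_mulVec, Matrix.one_mulVec]
  exact h y

/-- An affine bijection which is integral in both directions preserves the Lebesgue measure. -/
lemma measurePreserving_of_isIntAffine (f : (ι → ℝ) → κ → ℝ) (g : (κ → ℝ) → ι → ℝ)
    (hf : ∀ k, IsIntAffine fun x => f x k) (hg : ∀ i, IsIntAffine fun y => g y i)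
    (hgf : ∀ x, g (f x) = x) (hfg : ∀ y, f (g y) = y) : MeasurePreserving f := by
  classical
  choose A a hA using hf
  choose A' a' hA' using hg
  let M : Matrix κ ι ℤ := A
  let M' : Matrix ι κ ℤ := A'
  have hf' : ∀ x, f x = (M.map (Int.cast : ℤ → ℝ)).mulVec x + a := fun x => by
    ext k; simp [hA, M, Matrix.mulVec, dotProduct]; rfl
  have hg' : ∀ x, g x = (M'.map (Int.cast : ℤ → ℝ)).mulVec x + a' := fun x => by
    ext k; simp [hA', M', Matrix.mulVec, dotProduct]; rfl
  -- Comparing the identity at `y` with the one at `0` removes the translations.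
  have hMM' : M * M' = 1 := by
    refine mul_eq_one_of_mulVec _ _ fun y => ?_
    have h1 := hfg y
    have h0 := hfg 0
    simp only [hf', hg', Matrix.mulVec_add, Matrix.mulVec_zero, zero_add] at h0 h1
    rwa [add_assoc, h0, add_zero] at h1
  have hM'M : M' * M = 1 := by
    refine mul_eq_one_of_mulVec _ _ fun y => ?_
    have h1 := hgf y
    have h0 := hgf 0
    simp only [hf', hg', Matrix.mulVec_add, Matrix.mulVec_zero, zero_add] at h0 h1
    rwa [add_assoc, h0, add_zero] at h1
  have hcard : Fintype.card ι = Fintype.card κ := by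
    simpa using (LinearEquiv.finrank_eq (Matrix.toLin'OfInv hMM' hM'M)).symm
  -- Reindexing the target makes the matrix square, so that a determinant is available.
  let e : ι ≃ κ := Fintype.equivOfCardEq hcard
  have hR : M.submatrix e id * M'.submatrix id e = 1 := by
    rw [← Matrix.submatrix_mul _ _ _ _ _ Function.bijective_id, hMM', Matrix.submatrix_one_equiv]
  have h1 := measurePreserving_toLin'_of_int _ _ hR
  have h2 := (volume_measurePreserving_piCongrLeft (fun _ : κ => ℝ) e).comp h1
  have h3 := (measurePreserving_add_right (volume : Measure (κ → ℝ)) a).comp h2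
  refine (congrArg (fun φ : (ι → ℝ) → κ → ℝ => MeasurePreserving φ) ?_).mpr h3
  funext x k
  simp only [hf', Function.comp_apply, Pi.add_apply]
  congr 1
  obtain ⟨j, rfl⟩ := e.surjective k
  rw [MeasurableEquiv.coe_piCongrLeft, Equiv.piCongrLeft_apply_apply]
  rfl

end IntegralAffine

end Witten

namespace Witten

open Complex MeasureTheory

/-! ### From coordinates on the hyperplane to branch sums. -/

section ChangeOfVariables

variable {P V : Type} [Fintype P] [Fintype V]

open scoped Classical in
/-- The point of the hyperplane `∑ e, y e = T` with given coordinates other than that at `e₀`. -/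
noncomputable def fillSum {e₀ : P} (T : ℝ) (y : Rest e₀ → ℝ) : P → ℝ := fun e =>
  if he : e = e₀ then T - ∑ f, y f else y ⟨e, he⟩

open scoped Classical in
/-- The point of the hyperplane `w r = T` with given coordinates other than that at `r`. -/
noncomputable def fillValue {r : V} (T : ℝ) (w : Rest r → ℝ) : V → ℝ := fun a =>
  if ha : a = r then T else w ⟨a, ha⟩

lemma sum_eq_add_sum_rest {R : Type*} [AddCommMonoid R] (e₀ : P) (f : P → R) :
    ∑ e, f e = f e₀ + ∑ e : Rest e₀, f e.1 := by
  classical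
  rw [← Finset.add_sum_erase _ _ (Finset.mem_univ e₀)]
  congr 1
  exact Finset.sum_subtype _ (by simp) f

lemma fillSum_of_ne {e₀ : P} (T : ℝ) (y : Rest e₀ → ℝ) (e : Rest e₀) :
    fillSum T y e.1 = y e := by
  simp [fillSum, e.2]

lemma sum_fillSum {e₀ : P} (T : ℝ) (y : Rest e₀ → ℝ) : ∑ e, fillSum T y e = T := by
  rw [sum_eq_add_sum_rest e₀]
  simp only [fillSum_of_ne]
  simp [fillSum]

lemma fillSum_eq {e₀ : P} {T : ℝ} {z : P → ℝ} (hz : ∑ e, z e = T) :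
    fillSum (e₀ := e₀) T (fun e => z e.1) = z := by
  ext e
  by_cases h : e = e₀
  · subst h
    rw [sum_eq_add_sum_rest e] at hz
    simp only [fillSum, dif_pos]
    linarith
  · simp [fillSum, h]

omit [Fintype V] in
lemma fillValue_of_ne {r : V} (T : ℝ) (w : Rest r → ℝ) (a : Rest r) :
    fillValue T w a.1 = w a := by
  simp [fillValue, a.2]

omit [Fintype V] in
lemma fillValue_eq {r : V} {T : ℝ} {W : V → ℝ} (hW : W r = T) :
    fillValue (r := r) T (fun a => W a.1) = W := by
  ext a
  by_cases h : a = r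
  · subst h
    simp [fillValue, hW]
  · simp [fillValue, h]

lemma isIntAffine_fillSum {e₀ : P} (T : ℝ) (e : P) :
    IsIntAffine fun y : Rest e₀ → ℝ => fillSum T y e := by
  by_cases h : e = e₀
  · simp only [fillSum, dif_pos h]
    exact (IsIntAffine.const T).sub (IsIntAffine.sum _ fun f _ => IsIntAffine.apply f)
  · simp only [fillSum, dif_neg h]
    exact IsIntAffine.apply _

open scoped Classical in
lemma sum_filter_mem_eq {R : Type*} [AddCommMonoid R] (g : P → V) (f : P → R) (S : Set V) :
    ∑ e with g e ∈ S, f e = ∑ v with v ∈ S, ∑ e with g e = v, f e := by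
  rw [Finset.sum_filter, Finset.sum_filter]
  simp only [Finset.sum_filter]
  have h : ∀ v, (if v ∈ S then ∑ e, (if g e = v then f e else 0) else 0) =
      ∑ e, if g e = v then (if g e ∈ S then f e else 0) else 0 := by
    intro v
    by_cases hv : v ∈ S
    · rw [if_pos hv]
      refine Finset.sum_congr rfl fun e _ => ?_
      by_cases he : g e = v <;> simp [he, hv]
    · rw [if_neg hv]
      symm
      refine Finset.sum_eq_zero fun e _ => ?_
      by_cases he : g e = v <;> simp [he, hv]
  simp only [h]
  rw [Finset.sum_comm]
  simp

variable (β : P → V) (rep : V → P) (r : V) (br : V → Set V) (kids : V → Finset V)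

/-- The elements which are not the chosen representative of their fiber. -/
abbrev NonRep (β : P → V) (rep : V → P) : Type := {e : P // rep (β e) ≠ e}

noncomputable instance : Fintype (NonRep β rep) := Fintype.ofFinite _

variable {β rep} in
omit [Fintype P] [Fintype V] in
lemma bijective_elim_rep (hrep : ∀ v, β (rep v) = v) :
    Function.Bijective (Sum.elim (Subtype.val : NonRep β rep → P) rep) := by
  constructor
  · rintro (a | a) (b | b) h
    · exact congrArg _ (Subtype.ext h)
    · refine absurd ?_ a.2
      simp only [Sum.elim_inl, Sum.elim_inr] at h
      rw [h, hrep]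
    · refine absurd ?_ b.2
      simp only [Sum.elim_inl, Sum.elim_inr] at h
      rw [← h, hrep]
    · simp only [Sum.elim_inr] at h
      rw [← hrep a, h, hrep]
  · intro e
    by_cases h : rep (β e) = e
    · exact ⟨.inr (β e), h⟩
    · exact ⟨.inl ⟨e, h⟩, rfl⟩

open scoped Classical in
variable {β rep} in
lemma sum_fiber_eq (hrep : ∀ v, β (rep v) = v) {R : Type*} [AddCommMonoid R] (f : P → R) (v : V) :
    ∑ e with β e = v, f e = f (rep v) + ∑ q : NonRep β rep with β q.1 = v, f q.1 := by
  rw [Finset.sum_filter, ← (Equiv.ofBijective _ (bijective_elim_rep hrep)).sum_comp,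
    Fintype.sum_sum_type, Finset.sum_filter, add_comm]
  congr 1
  simp [hrep]

variable {β rep} in
lemma prod_eq_prod_rep (hrep : ∀ v, β (rep v) = v) {R : Type*} [CommMonoid R] (f : P → R) :
    ∏ e, f e = (∏ q : NonRep β rep, f q.1) * ∏ v, f (rep v) := by
  rw [← (Equiv.ofBijective _ (bijective_elim_rep hrep)).prod_comp, Fintype.prod_sum_type]
  simp

open scoped Classical in
/-- The total of `z` over the pairs whose vertex lies in the branch at `a`. -/
noncomputable def branchSum (z : P → ℝ) (a : V) : ℝ := ∑ e with β e ∈ br a, z e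

open scoped Classical in
lemma branchSum_eq (z : P → ℝ) (a : V) :
    branchSum β br z a = ∑ v with v ∈ br a, ∑ e with β e = v, z e :=
  sum_filter_mem_eq β z (br a)

open scoped Classical in
/-- The coordinates of the non-representatives and the branch sums, in terms of the coordinates
other than `e₀` of a point of the hyperplane `∑ e, y e = T`. -/
noncomputable def toBranch {e₀ : P} (T : ℝ) (y : Rest e₀ → ℝ) :
    NonRep β rep ⊕ Rest r → ℝ :=
  Sum.elim (fun q => fillSum T y q.1) (fun a => branchSum β br (fillSum T y) a.1)

open scoped Classical in
/-- The point of `P → ℝ` with given coordinates at the non-representatives and given branch sums. -/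
noncomputable def ofBranch (T : ℝ) (u : NonRep β rep ⊕ Rest r → ℝ) : P → ℝ := fun e =>
  if h : rep (β e) = e then
    (fillValue (r := r) T (fun a => u (.inr a)) (β e)
      - ∑ b ∈ kids (β e), fillValue (r := r) T (fun a => u (.inr a)) b)
      - ∑ q : NonRep β rep with β q.1 = β e, u (.inl q)
  else u (.inl ⟨e, h⟩)

variable {β rep r br kids}

-- The recursion says that taking differences with the children is a left inverse of summing over
-- branches. In finite dimension a left inverse is also a right inverse.
open scoped Classical in
lemma sum_branch_of_recursion
    (hkids : ∀ (f : V → ℝ) a, ∑ v with v ∈ br a, f v =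
      f a + ∑ b ∈ kids a, ∑ v with v ∈ br b, f v) (W : V → ℝ) (a : V) :
    ∑ v with v ∈ br a, (W v - ∑ b ∈ kids v, W b) = W a := by
  let S : (V → ℝ) →ₗ[ℝ] (V → ℝ) :=
    { toFun := fun f a => ∑ v with v ∈ br a, f v
      map_add' := fun f g => by ext a; simp [Finset.sum_add_distrib]
      map_smul' := fun c f => by ext a; simp [Finset.mul_sum] }
  let K : (V → ℝ) →ₗ[ℝ] (V → ℝ) :=
    { toFun := fun W a => W a - ∑ b ∈ kids a, W b
      map_add' := fun f g => by ext a; simp [Finset.sum_add_distrib]; ring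
      map_smul' := fun c f => by ext a; simp [Finset.mul_sum, mul_sub] }
  have h : K * S = 1 := by
    refine LinearMap.ext fun f => funext fun a => ?_
    have := hkids f a
    simp only [Module.End.mul_apply, Module.End.one_apply, S, K, LinearMap.coe_mk, AddHom.coe_mk]
    linarith
  have h' : S * K = 1 := mul_eq_one_comm.1 h
  exact congrFun (LinearMap.congr_fun h' W) a

open scoped Classical in
lemma sum_fiber_ofBranch (hrep : ∀ v, β (rep v) = v) (T : ℝ) (u : NonRep β rep ⊕ Rest r → ℝ)
    (v : V) : ∑ e with β e = v, ofBranch β rep r kids T u e =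
      fillValue (r := r) T (fun a => u (.inr a)) v
        - ∑ b ∈ kids v, fillValue (r := r) T (fun a => u (.inr a)) b := by
  rw [sum_fiber_eq hrep]
  have h1 : ∀ q : NonRep β rep, ofBranch β rep r kids T u q.1 = u (.inl q) := fun q => by
    simp [ofBranch, q.2]
  simp only [h1]
  rw [ofBranch, dif_pos (by rw [hrep])]
  simp only [hrep]
  ring

open scoped Classical in
lemma branchSum_ofBranch (hrep : ∀ v, β (rep v) = v)
    (hkids : ∀ (f : V → ℝ) a, ∑ v with v ∈ br a, f v =
      f a + ∑ b ∈ kids a, ∑ v with v ∈ br b, f v)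
    (T : ℝ) (u : NonRep β rep ⊕ Rest r → ℝ) :
    branchSum β br (ofBranch β rep r kids T u) =
      fillValue (r := r) T (fun a => u (.inr a)) := by
  ext a
  rw [branchSum_eq]
  simp only [sum_fiber_ofBranch hrep]
  exact sum_branch_of_recursion hkids _ a

omit [Fintype V] in
open scoped Classical in
lemma branchSum_root (hr : br r = Set.univ) (z : P → ℝ) : branchSum β br z r = ∑ e, z e := by
  simp [branchSum, hr]

open scoped Classical in
lemma fillSum_ofBranch (hrep : ∀ v, β (rep v) = v)
    (hkids : ∀ (f : V → ℝ) a, ∑ v with v ∈ br a, f v =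
      f a + ∑ b ∈ kids a, ∑ v with v ∈ br b, f v) (hr : br r = Set.univ) (e₀ : P)
    (T : ℝ) (u : NonRep β rep ⊕ Rest r → ℝ) :
    fillSum (e₀ := e₀) T (fun e => ofBranch β rep r kids T u e.1) =
      ofBranch β rep r kids T u := by
  apply fillSum_eq
  rw [← branchSum_root hr, branchSum_ofBranch hrep hkids]
  simp [fillValue]

open scoped Classical in
lemma ofBranch_toBranch (hrep : ∀ v, β (rep v) = v)
    (hkids : ∀ (f : V → ℝ) a, ∑ v with v ∈ br a, f v =
      f a + ∑ b ∈ kids a, ∑ v with v ∈ br b, f v) (hr : br r = Set.univ) {e₀ : P}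
    (T : ℝ) (y : Rest e₀ → ℝ) :
    ofBranch β rep r kids T (toBranch β rep r br T y) = fillSum T y := by
  have hW : fillValue (r := r) T (fun a => toBranch β rep r br T y (.inr a)) =
      branchSum β br (fillSum T y) := by
    simp only [toBranch, Sum.elim_inr]
    exact fillValue_eq (by rw [branchSum_root hr, sum_fillSum])
  have hX : ∀ v, branchSum β br (fillSum T y) v
      - ∑ b ∈ kids v, branchSum β br (fillSum T y) b = ∑ e with β e = v, fillSum T y e := by
    intro v
    have := hkids (fun v => ∑ e with β e = v, fillSum T y e) v
    simp only [← branchSum_eq] at this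
    linarith
  ext e
  by_cases h : rep (β e) = e
  · rw [ofBranch, dif_pos h, hW, hX, sum_fiber_eq hrep, h]
    simp [toBranch]
  · rw [ofBranch, dif_neg h]
    rfl

omit [Fintype V] in
lemma isIntAffine_fillValue {ι : Type} [Fintype ι] (T : ℝ) (g : Rest r → ι) (a : V) :
    IsIntAffine fun u : ι → ℝ => fillValue (r := r) T (fun a => u (g a)) a := by
  by_cases h : a = r
  · simp only [fillValue, dif_pos h]
    exact IsIntAffine.const T
  · simp only [fillValue, dif_neg h]
    exact IsIntAffine.apply _

open scoped Classical in
lemma isIntAffine_ofBranch (T : ℝ) (e : P) :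
    IsIntAffine fun u => ofBranch β rep r kids T u e := by
  by_cases h : rep (β e) = e
  · simp only [ofBranch, dif_pos h]
    refine IsIntAffine.sub (IsIntAffine.sub (isIntAffine_fillValue T _ _)
      (IsIntAffine.sum _ fun b _ => isIntAffine_fillValue T _ _))
      (IsIntAffine.sum _ fun q _ => IsIntAffine.apply _)
  · simp only [ofBranch, dif_neg h]
    exact IsIntAffine.apply _

omit [Fintype V] in
lemma isIntAffine_toBranch {e₀ : P} (T : ℝ) (k : NonRep β rep ⊕ Rest r) :
    IsIntAffine fun y : Rest e₀ → ℝ => toBranch β rep r br T y k := by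
  rcases k with q | a
  · exact isIntAffine_fillSum T _
  · exact IsIntAffine.sum _ fun e _ => isIntAffine_fillSum T _

lemma measurable_of_isIntAffine {ι : Type} [Fintype ι] {φ : (ι → ℝ) → ℝ} (h : IsIntAffine φ) :
    Measurable φ := by
  obtain ⟨n, c, h⟩ := h
  rw [show φ = fun x => ∑ i, (n i : ℝ) * x i + c from funext h]
  fun_prop

open scoped Classical in
/-- `toBranch` as a measurable bijection. -/
noncomputable def branchEquiv (hrep : ∀ v, β (rep v) = v)
    (hkids : ∀ (f : V → ℝ) a, ∑ v with v ∈ br a, f v =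
      f a + ∑ b ∈ kids a, ∑ v with v ∈ br b, f v) (hr : br r = Set.univ) (e₀ : P) (T : ℝ) :
    (Rest e₀ → ℝ) ≃ᵐ (NonRep β rep ⊕ Rest r → ℝ) where
  toFun := toBranch β rep r br T
  invFun u := fun e => ofBranch β rep r kids T u e.1
  left_inv y := by
    ext e
    simp only [ofBranch_toBranch hrep hkids hr, fillSum_of_ne]
  right_inv u := by
    ext k
    unfold toBranch
    rw [fillSum_ofBranch hrep hkids hr]
    rcases k with q | a
    · simp [ofBranch, q.2]
    · rw [Sum.elim_inr, branchSum_ofBranch hrep hkids]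
      simp only [fillValue_of_ne]
  measurable_toFun := measurable_pi_iff.2 fun k =>
    measurable_of_isIntAffine (isIntAffine_toBranch T k)
  measurable_invFun := measurable_pi_iff.2 fun e =>
    measurable_of_isIntAffine (isIntAffine_ofBranch T e.1)

open scoped Classical in
lemma measurePreserving_branchEquiv (hrep : ∀ v, β (rep v) = v)
    (hkids : ∀ (f : V → ℝ) a, ∑ v with v ∈ br a, f v =
      f a + ∑ b ∈ kids a, ∑ v with v ∈ br b, f v) (hr : br r = Set.univ) (e₀ : P) (T : ℝ) :
    MeasurePreserving (branchEquiv (r := r) hrep hkids hr e₀ T) :=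
  measurePreserving_of_isIntAffine _ (branchEquiv (r := r) hrep hkids hr e₀ T).symm
    (isIntAffine_toBranch T) (fun e => isIntAffine_ofBranch T e.1)
    (branchEquiv (r := r) hrep hkids hr e₀ T).symm_apply_apply
    (branchEquiv (r := r) hrep hkids hr e₀ T).apply_symm_apply

open scoped Classical in
/-- The integral over a hyperplane of a product of Beta functions and of a function of the branch
sums reduces to an integral over the branch sums. -/
theorem integral_hyperplane_eq (hrep : ∀ v, β (rep v) = v)
    (hkids : ∀ (f : V → ℝ) a, ∑ v with v ∈ br a, f v =
      f a + ∑ b ∈ kids a, ∑ v with v ∈ br b, f v) (hr : br r = Set.univ) (e₀ : P) (T : ℝ)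
    (x : P → ℝ) (δ : P → ℂ) (hx : ∀ e, 0 < x e) (hxδ : ∀ e, x e < (δ e).re)
    (F : (Rest r → ℝ) → ℂ)
    (hint : Integrable fun y : Rest e₀ → ℝ => F (fun a => branchSum β br (fillSum T y) a.1) *
      ∏ e, B (x e + fillSum T y e * I) (δ e)) :
    (Integrable fun w : Rest r → ℝ => F w * ∏ v, B (∑ e with β e = v, (x e : ℂ) +
      (fillValue T w v - ∑ b ∈ kids v, fillValue T w b : ℝ) * I) (∑ e with β e = v, δ e)) ∧
    (1 / (2 * Real.pi : ℂ)) ^ Fintype.card (Rest e₀) *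
      ∫ y : Rest e₀ → ℝ, F (fun a => branchSum β br (fillSum T y) a.1) *
        ∏ e, B (x e + fillSum T y e * I) (δ e) =
    (1 / (2 * Real.pi : ℂ)) ^ Fintype.card (Rest r) *
      ∫ w : Rest r → ℝ, F w * ∏ v, B (∑ e with β e = v, (x e : ℂ) +
      (fillValue T w v - ∑ b ∈ kids v, fillValue T w b : ℝ) * I) (∑ e with β e = v, δ e) := by
  let Φ := branchEquiv (r := r) hrep hkids hr e₀ T
  have hΦ : MeasurePreserving Φ := measurePreserving_branchEquiv hrep hkids hr e₀ T
  let Ψ := Φ.trans (MeasurableEquiv.sumPiEquivProdPi fun _ : NonRep β rep ⊕ Rest r => ℝ)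
  have hΨ : MeasurePreserving Ψ :=
    (volume_measurePreserving_sumPiEquivProdPi fun _ : NonRep β rep ⊕ Rest r => ℝ).comp hΦ
  -- The total of block `v`, recovered from the branch sums; at the root the branch sum has the
  -- fixed value `T`.
  let X : (Rest r → ℝ) → V → ℝ := fun w v => fillValue T w v - ∑ b ∈ kids v, fillValue T w b
  let H : (NonRep β rep → ℝ) × (Rest r → ℝ) → ℂ := fun p => F p.2 *
    ((∏ q : NonRep β rep, B (x q.1 + p.1 q * I) (δ q.1)) *
      ∏ v, B ((x (rep v) + X p.2 v * I) - (∑ q : NonRep β rep with β q.1 = v, p.1 q : ℝ) * I)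
        (δ (rep v)))
  have hH : ∀ y : Rest e₀ → ℝ, F (fun a => branchSum β br (fillSum T y) a.1) *
      ∏ e, B (x e + fillSum T y e * I) (δ e) = H (Ψ y) := by
    intro y
    have hW : fillValue (r := r) T (fun a => branchSum β br (fillSum T y) a.1) =
        branchSum β br (fillSum T y) :=
      fillValue_eq (by rw [branchSum_root hr, sum_fillSum])
    have h2 : (Ψ y).2 = fun a => branchSum β br (fillSum T y) a.1 := rfl
    have h1 : (Ψ y).1 = fun q => fillSum T y q.1 := rfl
    have hX : ∀ v, X (Ψ y).2 v = fillSum T y (rep v) +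
        ∑ q : NonRep β rep with β q.1 = v, fillSum T y q.1 := by
      intro v
      rw [← sum_fiber_eq hrep]
      simp only [X, h2, hW]
      have := hkids (fun v => ∑ e with β e = v, fillSum T y e) v
      simp only [← branchSum_eq] at this
      linarith
    simp only [H, hX, h1]
    rw [h2, prod_eq_prod_rep hrep]
    congr 2
    refine Finset.prod_congr rfl fun v _ => ?_
    congr 1
    push_cast
    ring
  have hHint : Integrable H := by
    rw [← hΨ.integrable_comp_emb Ψ.measurableEmbedding]
    exact hint.congr (Filter.Eventually.of_forall hH)
  -- At fixed branch sums `F` is constant, and the non-representatives are integrated out block by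
  -- block.
  have hinner : ∀ w : Rest r → ℝ, ∫ q : NonRep β rep → ℝ, H (q, w) =
      (2 * Real.pi : ℂ) ^ Fintype.card (NonRep β rep) * (F w * ∏ v, B (∑ e with β e = v, (x e : ℂ) +
      (fillValue T w v - ∑ b ∈ kids v, fillValue T w b : ℝ) * I) (∑ e with β e = v, δ e)) := by
    intro w
    simp only [H]
    rw [integral_const_mul, integral_prod_B (fun q : NonRep β rep => β q.1) (fun q => (x q.1 : ℂ))
      (fun q => δ q.1) (fun v => x (rep v) + X w v * I) (fun v => δ (rep v))
      (by simpa using fun e _ => hx e) (by simpa using fun e _ => hxδ e)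
      (by simpa using fun v => hx _) (by simpa using fun v => hxδ _)]
    have : ∀ v, (x (rep v) + X w v * I : ℂ) + ∑ q : NonRep β rep with β q.1 = v, (x q.1 : ℂ) =
        ∑ e with β e = v, (x e : ℂ) + (X w v : ℝ) * I := by
      intro v
      rw [sum_fiber_eq hrep]
      ring
    simp only [this, ← sum_fiber_eq hrep]
    ring
  have hpi : (2 * Real.pi : ℂ) ≠ 0 := by
    exact_mod_cast (by positivity : (2 * Real.pi) ≠ 0)
  have hpow : (2 * Real.pi : ℂ) ^ Fintype.card (NonRep β rep) ≠ 0 := pow_ne_zero _ hpi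
  rw [Measure.volume_eq_prod] at hHint
  constructor
  · have h := hHint.integral_prod_right
    simp only [hinner] at h
    exact (integrable_const_mul_iff (IsUnit.mk0 _ hpow) _).1 h
  · simp only [hH]
    rw [hΨ.integral_comp' (g := H), Measure.volume_eq_prod, integral_prod_symm _ hHint]
    simp only [hinner]
    rw [integral_const_mul, ← mul_assoc]
    congr 1
    -- Counting coordinates: Barnes' lemma contributes one `2π` per non-representative, exactly the
    -- difference between the two normalisations.
    have hc1 : Fintype.card P = Fintype.card (NonRep β rep) + Fintype.card V := by
      rw [← Fintype.card_sum]
      exact (Fintype.card_congr (Equiv.ofBijective _ (bijective_elim_rep hrep))).symm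
    have hc2 : Fintype.card P = 1 + Fintype.card (Rest e₀) := by
      rw [Fintype.card_eq_sum_ones, sum_eq_add_sum_rest e₀,
        Fintype.card_eq_sum_ones (α := Rest e₀)]
    have hc3 : Fintype.card V = 1 + Fintype.card (Rest r) := by
      rw [Fintype.card_eq_sum_ones, sum_eq_add_sum_rest r,
        Fintype.card_eq_sum_ones (α := Rest r)]
    rw [show Fintype.card (Rest e₀) = Fintype.card (Rest r) + Fintype.card (NonRep β rep) by omega,
      pow_add, mul_assoc, ← mul_pow, one_div_mul_cancel hpi, one_pow, mul_one]

end ChangeOfVariables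

end Witten

namespace Witten

/-! ### Branches, children and edge cuts of a rooted tree. -/

section RootedTrees

open SimpleGraph

variable {V : Type} {G : SimpleGraph V} {r : V}

/-- The parent is unique: geodesics to `y` and `y'`, prolonged to `x`, are both the unique path from
`r` to `x`. -/
lemma eq_of_adj_of_dist_lt (hG : G.IsTree) {x y y' : V} (h : G.Adj x y) (h' : G.Adj x y')
    (hd : G.dist r x = G.dist r y + 1) (hd' : G.dist r x = G.dist r y' + 1) : y = y' := by
  obtain ⟨p, hp, hpl⟩ := hG.connected.exists_path_of_dist r y
  obtain ⟨p', hp', hpl'⟩ := hG.connected.exists_path_of_dist r y'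
  have h1 : (p.concat h.symm).IsPath :=
    Walk.isPath_of_length_eq_dist _ (by rw [Walk.length_concat, hpl, hd])
  have h2 : (p'.concat h'.symm).IsPath :=
    Walk.isPath_of_length_eq_dist _ (by rw [Walk.length_concat, hpl', hd'])
  have h3 := (hG.existsUnique_path r x).unique h1 h2
  have h4 := congrArg Walk.penultimate h3
  simpa using h4

lemma exists_adj_dist (hG : G.Connected) {a v : V} (h : v ≠ a) :
    ∃ u, G.Adj v u ∧ G.dist a v = G.dist a u + 1 := by
  obtain ⟨p, -, hpl⟩ := hG.exists_path_of_dist v a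
  cases p with
  | nil => exact absurd rfl h
  | @cons _ u _ hadj q =>
    refine ⟨u, hadj, ?_⟩
    have h1 := dist_le q
    have h2 := hG.dist_triangle (u := v) (v := u) (w := a)
    have h3 : G.dist v u = 1 := dist_eq_one_iff_adj.2 hadj
    rw [Walk.length_cons] at hpl
    rw [G.dist_comm (u := a) (v := v), G.dist_comm (u := a) (v := u)]
    omega

lemma mem_branch {a v : V} :
    v ∈ branch G r a ↔ G.dist r v = G.dist r a + G.dist a v := Iff.rfl

lemma self_mem_branch (a : V) : a ∈ branch G r a := by
  rw [mem_branch, dist_self, add_zero]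

lemma branch_root : branch G r r = Set.univ := by
  ext v
  rw [mem_branch, dist_self, zero_add]
  simp

lemma branch_trans (hG : G.Connected) {a b v : V} (h : v ∈ branch G r b) (h' : b ∈ branch G r a) :
    v ∈ branch G r a := by
  rw [mem_branch] at *
  have h1 := hG.dist_triangle (u := a) (v := b) (w := v)
  have h2 := hG.dist_triangle (u := r) (v := a) (w := v)
  omega

lemma eq_of_mem_branch (hG : G.Connected) {a v : V} (h : v ∈ branch G r a)
    (hd : G.dist r v ≤ G.dist r a) : v = a := by
  rw [mem_branch] at h
  exact ((hG.dist_eq_zero_iff).1 (by omega : G.dist a v = 0)).symm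

lemma child_mem_branch (hG : G.Connected) {a u v : V} (h : u ∈ branch G r a) (hadj : G.Adj v u)
    (hd : G.dist r v = G.dist r u + 1) : v ∈ branch G r a := by
  rw [mem_branch] at *
  have h1 := hG.dist_triangle (u := a) (v := u) (w := v)
  have h2 := hG.dist_triangle (u := r) (v := a) (w := v)
  have h3 : G.dist u v = 1 := dist_eq_one_iff_adj.2 hadj.symm
  omega

/-- The neighbour of `v` on the way to `a` is also closer to `r`, hence it is the parent `u`. -/
lemma parent_mem_branch (hG : G.IsTree) {a u v : V} (h : v ∈ branch G r a) (hne : v ≠ a)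
    (hadj : G.Adj v u) (hd : G.dist r v = G.dist r u + 1) : u ∈ branch G r a := by
  obtain ⟨u', hadj', hd'⟩ := exists_adj_dist hG.connected hne
  rw [mem_branch] at h
  have h1 := hG.connected.dist_triangle (u := r) (v := a) (w := u')
  have h2 := hG.connected.dist_triangle (u := r) (v := u') (w := v)
  have h3 : G.dist u' v = 1 := dist_eq_one_iff_adj.2 hadj'.symm
  have h4 : u = u' := eq_of_adj_of_dist_lt hG hadj hadj' hd (by omega)
  subst h4
  rw [mem_branch]
  omega

/-- Branches that share a vertex are nested. Climb from `v` to `l`: as `a` is no deeper than `l`,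
the climb cannot leave the branch at `a` earlier. -/
lemma mem_branch_of_mem_of_mem (hG : G.IsTree) {a l : V} (hd : G.dist r a ≤ G.dist r l) :
    ∀ (n : ℕ) (v : V), G.dist r v = n → v ∈ branch G r a → v ∈ branch G r l → l ∈ branch G r a := by
  intro n
  induction n with
  | zero =>
    intro v hv _ hl
    rw [← eq_of_mem_branch hG.connected hl (by omega)]
    assumption
  | succ n ih =>
    intro v hv ha hl
    by_cases hvl : v = l
    · exact hvl ▸ ha
    · have hvr : v ≠ r := fun h => by simp [h] at hv
      obtain ⟨u, hadj, hu⟩ := exists_adj_dist hG.connected hvr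
      refine ih u (by omega) ?_ (parent_mem_branch hG hl hvl hadj hu)
      refine parent_mem_branch hG ha ?_ hadj hu
      rintro rfl
      exact hvl (eq_of_mem_branch hG.connected hl hd)

lemma mem_children {a b : V} :
    b ∈ children G r a ↔ G.Adj a b ∧ G.dist r b = G.dist r a + 1 := Iff.rfl

lemma mem_branch_of_mem_children (hG : G.Connected) {a b : V} (h : b ∈ children G r a) :
    b ∈ branch G r a :=
  child_mem_branch hG (self_mem_branch a) h.1.symm h.2

lemma not_mem_branch_of_mem_children {a b : V} (h : b ∈ children G r a) :
    a ∉ branch G r b := by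
  intro h'
  rw [mem_branch] at h'
  have := h.2
  omega

lemma exists_child_of_mem_branch (hG : G.Connected) {a v : V} (h : v ∈ branch G r a)
    (hne : v ≠ a) : ∃ b ∈ children G r a, v ∈ branch G r b := by
  obtain ⟨u, hadj, hu⟩ := exists_adj_dist hG (a := v) (v := a) (Ne.symm hne)
  rw [mem_branch] at h
  have h1 := hG.dist_triangle (u := r) (v := u) (w := v)
  have h2 := hG.dist_triangle (u := r) (v := a) (w := u)
  have h3 : G.dist a u = 1 := dist_eq_one_iff_adj.2 hadj
  rw [G.dist_comm (u := v) (v := a), G.dist_comm (u := v) (v := u)] at hu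
  refine ⟨u, ⟨hadj, by omega⟩, ?_⟩
  rw [mem_branch]
  omega

lemma children_unique (hG : G.IsTree) {a b b' v : V} (hb : b ∈ children G r a)
    (hb' : b' ∈ children G r a) (h : v ∈ branch G r b) (h' : v ∈ branch G r b') : b = b' := by
  have h1 := hb.2
  have h2 := hb'.2
  have h3 := mem_branch_of_mem_of_mem hG (by omega : G.dist r b ≤ G.dist r b') _ v rfl h h'
  exact (eq_of_mem_branch hG.connected h3 (by omega)).symm

-- A branch is the disjoint union of its top vertex and the branches at its children. This supplies
-- the recursion `hkids` of the change of variables.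
open scoped Classical in
lemma sum_branch_eq [Fintype V] (hG : G.IsTree) {R : Type*} [AddCommMonoid R] (f : V → R) (a : V) :
    ∑ v with v ∈ branch G r a, f v =
      f a + ∑ b with b ∈ children G r a, ∑ v with v ∈ branch G r b, f v := by
  have hset : (Finset.univ.filter fun v => v ∈ branch G r a) =
      insert a ((Finset.univ.filter fun b => b ∈ children G r a).biUnion
        fun b => Finset.univ.filter fun v => v ∈ branch G r b) := by
    ext v
    simp only [Finset.mem_filter, Finset.mem_univ, true_and, Finset.mem_insert,
      Finset.mem_biUnion]
    constructor
    · intro h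
      by_cases hv : v = a
      · exact Or.inl hv
      · exact Or.inr (exists_child_of_mem_branch hG.connected h hv)
    · rintro (rfl | ⟨b, hb, hv⟩)
      · exact self_mem_branch v
      · exact branch_trans hG.connected hv (mem_branch_of_mem_children hG.connected hb)
  rw [hset, Finset.sum_insert, Finset.sum_biUnion]
  · intro b hb b' hb' hne
    rw [Function.onFun, Finset.disjoint_left]
    intro v hv hv'
    simp only [Finset.coe_filter, Finset.mem_filter, Finset.mem_univ, true_and,
      Set.mem_ofPred_eq] at hb hb' hv hv'
    exact hne (children_unique hG hb hb' hv hv')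
  · simp only [Finset.mem_biUnion, Finset.mem_filter, Finset.mem_univ, true_and, not_exists,
      not_and]
    exact fun b hb => not_mem_branch_of_mem_children hb

/-- A set of vertices which is one of the two sides of an edge: exactly one edge leads into it. -/
def IsSide (G : SimpleGraph V) (S : Set V) : Prop :=
  ∃ u v, G.Adj u v ∧ u ∉ S ∧ v ∈ S ∧ ∀ x y, G.Adj x y → x ∉ S → y ∈ S → x = u ∧ y = v

lemma IsSide.compl {S : Set V} (h : IsSide G S) : IsSide G Sᶜ := by
  obtain ⟨u, v, hadj, hu, hv, h⟩ := h
  refine ⟨v, u, hadj.symm, by simpa using hv, hu, fun x y hxy hx hy => ?_⟩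
  obtain ⟨h1, h2⟩ := h y x hxy.symm hy (by simpa using hx)
  exact ⟨h2, h1⟩

lemma isSide_branch (hG : G.IsTree) {a : V} (ha : a ≠ r) : IsSide G (branch G r a) := by
  obtain ⟨u, hadj, hu⟩ := exists_adj_dist hG.connected ha
  refine ⟨u, a, hadj.symm, ?_, self_mem_branch a, fun x y hxy hx hy => ?_⟩
  · intro h
    rw [mem_branch] at h
    omega
  · rcases hG.dist_eq_dist_add_one_of_adj r hxy with h | h
    · exact absurd (child_mem_branch hG.connected hy hxy h) hx
    · have hya : y = a := by
        by_contra hne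
        exact hx (parent_mem_branch hG hy hne hxy.symm h)
      subst hya
      exact ⟨eq_of_adj_of_dist_lt hG hxy.symm hadj h hu, rfl⟩

/-- Climbing towards the root from a point of `S`, one must leave through the only edge `uv`, so `S`
lies below `v`. Conversely `u` is the parent of `v`, and no edge below `v` can leave `S`. Sides make
no reference to a root, which matters because each insertion chooses its own. -/
lemma IsSide.eq_branch (hG : G.IsTree) {S : Set V} (h : IsSide G S) (hr : r ∉ S) :
    ∃ a, a ≠ r ∧ S = branch G r a := by
  obtain ⟨u, v, hadj, hu, hv, h⟩ := h
  have hvr : v ≠ r := fun e => hr (e ▸ hv)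
  have h1 : ∀ (n : ℕ) (x : V), G.dist r x = n → x ∈ S → x ∈ branch G r v := by
    intro n
    induction n with
    | zero =>
      intro x hx hxS
      rw [hG.connected.dist_eq_zero_iff] at hx
      exact absurd (hx ▸ hxS) hr
    | succ n ih =>
      intro x hx hxS
      have hxr : x ≠ r := fun h => by simp [h] at hx
      obtain ⟨p, hp, hd⟩ := exists_adj_dist hG.connected hxr
      by_cases hpS : p ∈ S
      · exact child_mem_branch hG.connected (ih p (by omega) hpS) hp hd
      · rw [(h p x hp.symm hpS hxS).2]
        exact self_mem_branch v
  have hparent : G.dist r v = G.dist r u + 1 := by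
    obtain ⟨p, hp, hd⟩ := exists_adj_dist hG.connected hvr
    have hpS : p ∉ S := by
      intro hpS
      have := h1 _ p rfl hpS
      rw [mem_branch] at this
      omega
    rw [← (h p v hp.symm hpS hv).1, hd]
  have h2 : ∀ (n : ℕ) (x : V), G.dist r x = n → x ∈ branch G r v → x ∈ S := by
    intro n
    induction n with
    | zero =>
      intro x hx hxv
      rw [mem_branch] at hxv
      omega
    | succ n ih =>
      intro x hx hxv
      by_cases hne : x = v
      · exact hne ▸ hv
      · have hxr : x ≠ r := fun h => by simp [h] at hx
        obtain ⟨p, hp, hd⟩ := exists_adj_dist hG.connected hxr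
        have hpS := ih p (by omega) (parent_mem_branch hG hxv hne hp hd)
        by_contra hxS
        obtain ⟨rfl, rfl⟩ := h x p hp hxS hpS
        omega
  exact ⟨v, hvr, Set.ext fun x => ⟨h1 _ x rfl, h2 _ x rfl⟩⟩

end RootedTrees

/-! ### The tree after a vertex insertion. -/

section Insertion

open SimpleGraph

variable {V N A₀ : Type} {G : SimpleGraph V} {r : V}

lemma insertGraph_adj_some {x y : V} :
    (insertGraph G r).Adj (some x) (some y) ↔ G.Adj x y := by
  simp only [insertGraph, sup_adj, SimpleGraph.map_adj, edge_adj]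
  simp

lemma insertGraph_adj_none {y : Option V} :
    (insertGraph G r).Adj none y ↔ y = some r := by
  simp only [insertGraph, sup_adj, SimpleGraph.map_adj, edge_adj]
  rcases y with _ | y <;> simp

lemma isTree_insertGraph [Finite V] (hG : G.IsTree) (r : V) : (insertGraph G r).IsTree := by
  obtain ⟨hc, hcard⟩ := isTree_iff_connected_and_card.1 hG
  refine isTree_iff_connected_and_card.2 ⟨?_, ?_⟩
  · have h1 : ∀ x y : V, (insertGraph G r).Reachable (some x) (some y) := by
      intro x y
      obtain ⟨p⟩ := hc.preconnected x y
      exact ⟨p.map ⟨some, fun h => insertGraph_adj_some.2 h⟩⟩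
    have h2 : (insertGraph G r).Reachable none (some r) :=
      (insertGraph_adj_none.2 rfl).reachable
    have : Nonempty (Option V) := ⟨none⟩
    refine ⟨?_⟩
    rintro (_ | x) (_ | y)
    · rfl
    · exact h2.trans (h1 r y)
    · exact (h2.trans (h1 r x)).symm
    · exact h1 x y
  · have hset : (insertGraph G r).edgeSet =
        insert s(none, some r) (Sym2.map some '' G.edgeSet) := by
      rw [insertGraph, edgeSet_sup, edgeSet_edge_of_ne (by simp), edgeSet_map]
      rw [Set.union_comm, Set.singleton_union]
      rfl
    have hnot : s(none, some r) ∉ Sym2.map some '' G.edgeSet := by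
      rintro ⟨e, -, he⟩
      have : (none : Option V) ∈ Sym2.map some e := he ▸ Sym2.mem_mk_left _ _
      simp [Sym2.mem_map] at this
    rw [hset, Nat.card_coe_set_eq, Set.ncard_insert_of_notMem hnot (Set.toFinite _),
      Set.ncard_image_of_injective _ (Sym2.map.injective (Option.some_injective V)),
      ← Nat.card_coe_set_eq, hcard, Finite.card_option]

/-- The one entering edge is the old parent edge of `a`, or the new edge if `a = r`. Thus each
`s_(a)` is a Mandelstam variable of a propagator of the new diagram. -/
lemma isSide_insertGraph_branch (hG : G.IsTree) (r a : V) :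
    IsSide (insertGraph G r) (some '' branch G r a) := by
  by_cases ha : a = r
  · subst ha
    refine ⟨none, some a, insertGraph_adj_none.2 rfl, by simp, ⟨a, self_mem_branch a, rfl⟩, ?_⟩
    intro x y hxy hx hy
    rcases x with _ | x
    · exact ⟨rfl, insertGraph_adj_none.1 hxy⟩
    · exact absurd ⟨x, by simp [branch_root], rfl⟩ hx
  · obtain ⟨u, v, hadj, hu, hv, h⟩ := isSide_branch hG ha
    refine ⟨some u, some v, insertGraph_adj_some.2 hadj, by simpa using hu, ⟨v, hv, rfl⟩, ?_⟩
    rintro x y hxy hx ⟨y, hy, rfl⟩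
    rcases x with _ | x
    · obtain rfl := Option.some_injective _ (insertGraph_adj_none.1 hxy)
      rw [mem_branch, dist_self] at hy
      have : G.dist y a ≠ 0 := fun h0 => ha ((hG.connected.dist_eq_zero_iff.1 h0).symm)
      omega
    · obtain ⟨rfl, rfl⟩ := h x y (insertGraph_adj_some.1 hxy) (by simpa using hx) hy
      exact ⟨rfl, rfl⟩

/-- At `att i₀` the new edge makes up for the lost point `i₀`; the new vertex has one edge and at
least two points. -/
lemma three_le_valency_insert [Finite V] [Finite N] [Fintype A₀] {att : N → V}
    (hval : ∀ v, 3 ≤ valency G att v) (i₀ : N) (hA₀ : 2 ≤ Fintype.card A₀) (v : Option V) :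
    3 ≤ valency (insertGraph G (att i₀)) (insertAtt att i₀ A₀) v := by
  rcases v with _ | v
  · have h1 : (insertGraph G (att i₀)).neighborSet none = {some (att i₀)} := by
      ext y
      rw [mem_neighborSet, insertGraph_adj_none, Set.mem_singleton_iff]
    have h2 : {x | insertAtt att i₀ A₀ x = none} = Set.range Sum.inr := by
      ext x
      rcases x with x | x <;> simp [insertAtt]
    rw [valency, h1, h2, Set.ncard_singleton, ← Set.image_univ,
      Set.ncard_image_of_injective _ Sum.inr_injective, Set.ncard_univ, Nat.card_eq_fintype_card]
    omega
  · have h2 : {x | insertAtt att i₀ A₀ x = some v}.ncard = ({i | att i = v} \ {i₀}).ncard := by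
      have h3 : {x | insertAtt att i₀ A₀ x = some v} =
          Sum.inl '' {k : Rest i₀ | att k.1 = v} := by
        ext x
        rcases x with x | x <;> simp [insertAtt]
      have h4 : {i | att i = v} \ {i₀} = Subtype.val '' {k : Rest i₀ | att k.1 = v} := by
        ext i
        simp [and_comm]
      rw [h3, h4, Set.ncard_image_of_injective _ Sum.inl_injective,
        Set.ncard_image_of_injective _ Subtype.val_injective]
    have h5 := hval v
    unfold valency at h5 ⊢
    rw [h2]
    by_cases hv : v = att i₀
    · have h1 : (insertGraph G (att i₀)).neighborSet (some v) =
          insert none (some '' G.neighborSet v) := by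
        ext y
        rcases y with _ | y
        · rw [mem_neighborSet, adj_comm, insertGraph_adj_none]
          simp [hv]
        · simp [mem_neighborSet, insertGraph_adj_some]
      rw [h1, Set.ncard_insert_of_notMem (by simp) (Set.toFinite _),
        Set.ncard_image_of_injective _ (Option.some_injective V)]
      have h6 := Set.ncard_sdiff_singleton_add_one (s := {i | att i = v}) (a := i₀) hv.symm
        (Set.toFinite _)
      omega
    · have h1 : (insertGraph G (att i₀)).neighborSet (some v) = some '' G.neighborSet v := by
        ext y
        rcases y with _ | y
        · rw [mem_neighborSet, adj_comm, insertGraph_adj_none]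
          simp [hv]
        · simp [mem_neighborSet, insertGraph_adj_some]
      rw [h1, Set.ncard_image_of_injective _ (Option.some_injective V),
        Set.sdiff_singleton_eq_self (fun h => hv h.symm)]
      exact h5

end Insertion

/-! ### Blocks of pairs with a common meet. -/

section Meet

open SimpleGraph

variable {V N : Type} [Finite V] [Finite N] {G : SimpleGraph V} {att : N → V} {i₀ : N}

/-- Of the at least three propagators at `a`, just one leads towards `i₀`: the parent edge, or that
of `i₀` itself at the root. -/
lemma two_le_children_add_points (hG : G.IsTree) (hval : ∀ v, 3 ≤ valency G att v) (a : V) :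
    2 ≤ (children G (att i₀) a).ncard + {k | k ≠ i₀ ∧ att k = a}.ncard := by
  have h := hval a
  unfold valency at h
  have hpts : {k | k ≠ i₀ ∧ att k = a} = {k | att k = a} \ {i₀} := by
    ext k
    simp [and_comm]
  rw [hpts]
  by_cases ha : a = att i₀
  · have h1 := Set.ncard_sdiff_singleton_add_one (s := {i | att i = a}) (a := i₀) ha.symm
      (Set.toFinite _)
    have h2 : G.neighborSet a = children G (att i₀) a := by
      ext b
      rw [mem_neighborSet, mem_children]
      constructor
      · intro hb
        refine ⟨hb, ?_⟩
        rw [← ha, dist_self, dist_eq_one_iff_adj.2 hb]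
      · exact fun hb => hb.1
    rw [h2] at h
    omega
  · rw [Set.sdiff_singleton_eq_self (fun h => ha h.symm)]
    obtain ⟨u, hadj, hu⟩ := exists_adj_dist hG.connected ha
    have h2 : G.neighborSet a ⊆ insert u (children G (att i₀) a) := by
      intro b hb
      rw [mem_neighborSet] at hb
      rcases hG.dist_eq_dist_add_one_of_adj (att i₀) hb with h' | h'
      · exact Or.inl (eq_of_adj_of_dist_lt hG hb hadj h' hu)
      · exact Or.inr ⟨hb, h'⟩
    have h3 := Set.ncard_le_ncard h2 (Set.toFinite _)
    have h4 := Set.ncard_insert_le u (children G (att i₀) a)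
    omega

/-- A deepest vertex of the branch has no children, so it carries points. -/
lemma exists_point_mem_branch (hG : G.IsTree) (hval : ∀ v, 3 ≤ valency G att v) (a : V) :
    ∃ k, k ≠ i₀ ∧ att k ∈ branch G (att i₀) a := by
  obtain ⟨v, hv, hmax⟩ := Set.exists_max_image (branch G (att i₀) a) (G.dist (att i₀))
    (Set.toFinite _) ⟨a, self_mem_branch a⟩
  have h := two_le_children_add_points (i₀ := i₀) hG hval v
  have hc : children G (att i₀) v = ∅ := by
    refine Set.eq_empty_of_forall_notMem fun b hb => ?_
    have h1 := hmax b (branch_trans hG.connected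
      (mem_branch_of_mem_children hG.connected hb) hv)
    have h2 := hb.2
    omega
  rw [hc, Set.ncard_empty, zero_add] at h
  obtain ⟨k, hk⟩ := Set.nonempty_of_ncard_ne_zero
    (s := {k | k ≠ i₀ ∧ att k = v}) (by omega)
  exact ⟨k, hk.1, by rw [hk.2]; exact hv⟩

/-- All points of the pair `e` are attached to the branch at `a`. -/
def IsBelow (G : SimpleGraph V) (att : N → V) {i₀ : N} (a : V) (e : Pr (Rest i₀)) : Prop :=
  ∀ k ∈ e.1, att k.1 ∈ branch G (att i₀) a

omit [Finite N] in
lemma exists_meet (G : SimpleGraph V) (att : N → V) (e : Pr (Rest i₀)) :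
    ∃ l, IsBelow G att l e ∧
      ∀ a, IsBelow G att a e → G.dist (att i₀) a ≤ G.dist (att i₀) l := by
  obtain ⟨l, hl, hmax⟩ := Set.exists_max_image {a | IsBelow G att a e} (G.dist (att i₀))
    (Set.toFinite _) ⟨att i₀, fun k _ => by rw [branch_root]; trivial⟩
  exact ⟨l, hl, hmax⟩

/-- The vertex furthest from the root whose branch contains both points of a pair. -/
noncomputable def meet (G : SimpleGraph V) (att : N → V) {i₀ : N} (e : Pr (Rest i₀)) : V :=
  (exists_meet G att e).choose

omit [Finite N] in
lemma meet_mem_branch_iff (hG : G.IsTree) (a : V) (e : Pr (Rest i₀)) :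
    meet G att e ∈ branch G (att i₀) a ↔ IsBelow G att a e := by
  obtain ⟨h1, h2⟩ := (exists_meet G att e).choose_spec
  constructor
  · exact fun h k hk => branch_trans hG.connected (h1 k hk) h
  · intro h
    obtain ⟨⟨i, j⟩, he⟩ := e
    exact mem_branch_of_mem_of_mem hG (h2 a h) _ _ rfl (h i (Sym2.mem_mk_left _ _))
      (h1 i (Sym2.mem_mk_left _ _))

/-- Two of the downward propagators at `a` lead to two points that lie below no common child,
whether these propagators are attached points or edges. The meet of such a pair is `a`. -/
lemma exists_meet_eq (hG : G.IsTree) (hval : ∀ v, 3 ≤ valency G att v) (a : V) :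
    ∃ e : Pr (Rest i₀), meet G att e = a := by
  have key : ∃ k k' : N, k ≠ i₀ ∧ k' ≠ i₀ ∧ k ≠ k' ∧ att k ∈ branch G (att i₀) a ∧
      att k' ∈ branch G (att i₀) a ∧ ∀ b ∈ children G (att i₀) a,
        ¬ (att k ∈ branch G (att i₀) b ∧ att k' ∈ branch G (att i₀) b) := by
    have h := two_le_children_add_points (i₀ := i₀) hG hval a
    by_cases hp : 1 < {k | k ≠ i₀ ∧ att k = a}.ncard
    · obtain ⟨k, hk, k', hk', hne⟩ := (Set.one_lt_ncard (Set.toFinite _)).1 hp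
      refine ⟨k, k', hk.1, hk'.1, hne, hk.2 ▸ self_mem_branch _, hk'.2 ▸ self_mem_branch _, ?_⟩
      rintro b hb ⟨h1, -⟩
      exact not_mem_branch_of_mem_children hb (hk.2 ▸ h1)
    by_cases hp' : {k | k ≠ i₀ ∧ att k = a}.ncard = 0
    · obtain ⟨b, hb, b', hb', hne⟩ := (Set.one_lt_ncard (Set.toFinite _)).1
        (by omega : 1 < (children G (att i₀) a).ncard)
      obtain ⟨k, hk, hkb⟩ := exists_point_mem_branch (i₀ := i₀) hG hval b
      obtain ⟨k', hk', hkb'⟩ := exists_point_mem_branch (i₀ := i₀) hG hval b'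
      refine ⟨k, k', hk, hk', ?_,
        branch_trans hG.connected hkb (mem_branch_of_mem_children hG.connected hb),
        branch_trans hG.connected hkb' (mem_branch_of_mem_children hG.connected hb'), ?_⟩
      · rintro rfl
        exact hne (children_unique hG hb hb' hkb hkb')
      · rintro c hc ⟨h1, h2⟩
        exact hne ((children_unique hG hb hc hkb h1).trans (children_unique hG hc hb' h2 hkb'))
    · obtain ⟨k, hk⟩ := Set.nonempty_of_ncard_ne_zero hp'
      obtain ⟨b, hb⟩ := Set.nonempty_of_ncard_ne_zero
        (by omega : (children G (att i₀) a).ncard ≠ 0)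
      obtain ⟨k', hk', hkb'⟩ := exists_point_mem_branch (i₀ := i₀) hG hval b
      refine ⟨k, k', hk.1, hk', ?_, hk.2 ▸ self_mem_branch _,
        branch_trans hG.connected hkb' (mem_branch_of_mem_children hG.connected hb), ?_⟩
      · rintro rfl
        exact not_mem_branch_of_mem_children hb (hk.2 ▸ hkb')
      · rintro c hc ⟨h1, -⟩
        exact not_mem_branch_of_mem_children hc (hk.2 ▸ h1)
  obtain ⟨k, k', hk, hk', hne, ha, ha', hno⟩ := key
  let e : Pr (Rest i₀) := ⟨s(⟨k, hk⟩, ⟨k', hk'⟩), by simpa using hne⟩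
  have hbelow : ∀ b, IsBelow G att b e ↔
      att k ∈ branch G (att i₀) b ∧ att k' ∈ branch G (att i₀) b := by
    intro b
    simp [IsBelow, e, Sym2.mem_iff]
  refine ⟨e, ?_⟩
  by_contra hea
  obtain ⟨b, hb, hmb⟩ := exists_child_of_mem_branch hG.connected
    ((meet_mem_branch_iff hG a e).2 ((hbelow a).2 ⟨ha, ha'⟩)) hea
  exact hno b hb ((hbelow b).1 ((meet_mem_branch_iff hG b e).1 hmb))

end Meet

end Witten

namespace Witten

open Complex MeasureTheory

/-! ### Mandelstam variables as sums over a cut. -/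

section Mandelstam

variable {N N' : Type} [Fintype N] [Fintype N'] {R : Type} [CommRing R]

omit [Fintype N] [Fintype N'] in
lemma Pr.mem_map {f : N ↪ N'} {e : Pr N} {x : N'} : x ∈ (e.map f).1 ↔ ∃ k ∈ e.1, f k = x :=
  Sym2.mem_map

omit [Fintype N] [Fintype N'] in
lemma Pr.map_injective (f : N ↪ N') : Function.Injective (Pr.map f) := fun _ _ h =>
  Subtype.ext (Sym2.map.injective f.injective (congrArg Subtype.val h))

lemma mandelstam_image (f : N ↪ N') (Δ : N' → R) (τ : Pr N' → R) (S : Set N) :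
    mandelstam Δ τ (f '' S) = mandelstam (fun k => Δ (f k)) (fun e => τ (e.map f)) S := by
  classical
  unfold mandelstam
  congr 1
  · symm
    refine Finset.sum_nbij f ?_ f.injective.injOn ?_ fun _ _ => rfl
    · intro k hk
      simpa using hk
    · rintro x hx
      simpa using hx
  · congr 1
    symm
    refine Finset.sum_nbij (Pr.map f) ?_ (Pr.map_injective f).injOn ?_ fun _ _ => rfl
    · intro e he
      simp only [Finset.mem_filter, Finset.mem_univ, true_and] at he ⊢
      intro x hx
      obtain ⟨k, hk, rfl⟩ := Pr.mem_map.1 hx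
      exact ⟨k, he k hk, rfl⟩
    · rintro ⟨⟨x, y⟩, hne⟩ he
      simp only [Finset.coe_filter, Finset.mem_univ, true_and, Set.mem_ofPred_eq] at he
      obtain ⟨i, hi, rfl⟩ := he x (Sym2.mem_mk_left _ _)
      obtain ⟨j, hj, rfl⟩ := he y (Sym2.mem_mk_right _ _)
      refine ⟨⟨s(i, j), fun h => hne ?_⟩, ?_, rfl⟩
      · rw [Sym2.mk_isDiag_iff] at h
        exact Sym2.mk_isDiag_iff.2 (congrArg f h)
      · simp only [Finset.coe_filter, Finset.mem_univ, true_and, Set.mem_ofPred_eq]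
        intro k hk
        rcases Sym2.mem_iff.1 hk with rfl | rfl <;> assumption

-- Expanding each `Δ_i` by its constraint counts a pair once per element in `S`; subtracting twice
-- the inner pairs leaves those with exactly one element in `S`. This form is symmetric under
-- complement.
open scoped Classical in
lemma mandelstam_eq_sum_cut {Δ : N → R} {τ : Pr N → R} (h : Canonical Δ τ) (S : Set N) :
    mandelstam Δ τ S = ∑ e : Pr N with (¬ ∀ i ∈ e.1, i ∈ S) ∧ ¬ ∀ i ∈ e.1, i ∈ Sᶜ, τ e := by
  unfold mandelstam
  have hΔ : ∀ i, Δ i = ∑ e : Pr N with i ∈ e.1, τ e := fun i => (h i).symm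
  simp only [hΔ]
  have h1 : ∑ i with i ∈ S, ∑ e : Pr N with i ∈ e.1, τ e =
      ∑ e : Pr N, ∑ i with i ∈ S, if i ∈ e.1 then τ e else 0 := by
    rw [Finset.sum_comm]
    refine Finset.sum_congr rfl fun i _ => ?_
    rw [Finset.sum_filter]
  rw [h1, Finset.sum_filter, Finset.sum_filter, Finset.mul_sum, ← Finset.sum_sub_distrib]
  refine Finset.sum_congr rfl fun e _ => ?_
  obtain ⟨⟨i, j⟩, hne⟩ := e
  have hij : i ≠ j := fun h => hne (Sym2.mk_isDiag_iff.2 h)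
  have h2 : ∀ k, (if k ∈ (Quot.mk _ (i, j) : Sym2 N) then τ ⟨Quot.mk _ (i, j), hne⟩ else 0) =
      (if k = i then τ ⟨Quot.mk _ (i, j), hne⟩ else 0) +
        if k = j then τ ⟨Quot.mk _ (i, j), hne⟩ else 0 := by
    intro k
    have : k ∈ (Quot.mk _ (i, j) : Sym2 N) ↔ k = i ∨ k = j := Sym2.mem_iff
    simp only [this]
    by_cases hi : k = i
    · subst hi
      simp [hij]
    · simp [hi]
  have h3 : ∀ T : Set N, (∀ k ∈ (Quot.mk _ (i, j) : Sym2 N), k ∈ T) ↔ i ∈ T ∧ j ∈ T := by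
    intro T
    exact Sym2.ball (p := fun k => k ∈ T)
  simp only [h2, h3, Finset.sum_add_distrib, Finset.sum_ite_eq', Finset.mem_filter,
    Finset.mem_univ, true_and, Set.mem_compl_iff]
  by_cases hi : i ∈ S <;> by_cases hj : j ∈ S <;> simp [hi, hj]
  ring

lemma mandelstam_compl {Δ : N → R} {τ : Pr N → R} (h : Canonical Δ τ) (S : Set N) :
    mandelstam Δ τ Sᶜ = mandelstam Δ τ S := by
  classical
  rw [mandelstam_eq_sum_cut h, mandelstam_eq_sum_cut h]
  refine Finset.sum_congr ?_ fun _ _ => rfl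
  ext e
  simp only [compl_compl, Finset.mem_filter, and_comm]

lemma mandelstam_univ (Δ : N → R) (τ : Pr N → R) :
    mandelstam Δ τ Set.univ = ∑ i, Δ i - 2 * ∑ e, τ e := by
  simp [mandelstam]

end Mandelstam

/-! ### Solving the constraints for the dependent Mellin variables. -/

section Solve

variable {N : Type} [Fintype N] {i₀ : N}

/-- The pair consisting of `i₀` and of another point. -/
def starPair (k : Rest i₀) : Pr N := ⟨s(i₀, k.1), fun h => k.2 (Sym2.mk_isDiag_iff.1 h).symm⟩

/-- A pair of points different from `i₀`, as a pair of points. -/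
abbrev innerPair (e : Pr (Rest i₀)) : Pr N := e.map (Function.Embedding.subtype _)

omit [Fintype N] in
lemma not_mem_innerPair (e : Pr (Rest i₀)) : i₀ ∉ (innerPair e).1 := by
  intro h
  obtain ⟨k, -, hk⟩ := Sym2.mem_map.1 h
  exact k.2 hk

omit [Fintype N] in
lemma mem_innerPair {e : Pr (Rest i₀)} {k : Rest i₀} : k.1 ∈ (innerPair e).1 ↔ k ∈ e.1 := by
  constructor
  · intro h
    obtain ⟨k', hk', h⟩ := Sym2.mem_map.1 h
    exact (Subtype.ext h) ▸ hk'
  · exact fun h => Sym2.mem_map.2 ⟨k, h, rfl⟩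

omit [Fintype N] in
lemma innerPair_restrict (e : Pr N) (h : i₀ ∉ e.1) : innerPair (e.restrict h) = e := by
  apply Subtype.ext
  change Sym2.map Subtype.val (Sym2.attachWith e.1 _) = e.1
  simp

omit [Fintype N] in
lemma starPair_other (e : Pr N) (h : i₀ ∈ e.1) (h' : Sym2.Mem.other h ≠ i₀) :
    starPair ⟨Sym2.Mem.other h, h'⟩ = e :=
  Subtype.ext (Sym2.other_spec h)

omit [Fintype N] in
lemma other_ne (e : Pr N) (h : i₀ ∈ e.1) : Sym2.Mem.other h ≠ i₀ := by
  intro h'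
  have h1 := Sym2.other_spec h
  rw [h'] at h1
  exact e.2 (h1 ▸ Sym2.mk_isDiag_iff.2 rfl)

omit [Fintype N] in
lemma other_starPair (k : Rest i₀) (h : i₀ ∈ (starPair k).1) : Sym2.Mem.other h = k.1 := by
  have h1 := Sym2.other_spec h
  exact Sym2.congr_right.1 h1

omit [Fintype N] in
lemma bijective_pairs : Function.Bijective
    (Sum.elim (starPair : Rest i₀ → Pr N) (innerPair : Pr (Rest i₀) → Pr N)) := by
  constructor
  · rintro (a | a) (b | b) h
    · have h1 := congrArg Subtype.val h
      exact congrArg _ (Subtype.ext (Sym2.congr_right.1 h1))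
    · refine absurd ?_ (not_mem_innerPair b)
      simp only [Sum.elim_inl, Sum.elim_inr] at h
      rw [← h]
      exact Sym2.mem_mk_left _ _
    · refine absurd ?_ (not_mem_innerPair a)
      simp only [Sum.elim_inl, Sum.elim_inr] at h
      rw [h]
      exact Sym2.mem_mk_left _ _
    · refine congrArg _ ?_
      simp only [Sum.elim_inr] at h
      exact Subtype.ext (Sym2.map.injective Subtype.val_injective (congrArg Subtype.val h))
  · intro e
    by_cases h : i₀ ∈ e.1
    · exact ⟨.inl ⟨_, other_ne e h⟩, starPair_other e h _⟩
    · exact ⟨.inr (e.restrict h), innerPair_restrict e h⟩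

lemma sum_pairs {R : Type*} [AddCommMonoid R] (f : Pr N → R) :
    ∑ e, f e = ∑ k : Rest i₀, f (starPair k) + ∑ e : Pr (Rest i₀), f (innerPair e) := by
  rw [← (Equiv.ofBijective _ (bijective_pairs (i₀ := i₀))).sum_comp, Fintype.sum_sum_type]
  simp

open scoped Classical in
lemma sum_pairs_mem {R : Type*} [AddCommMonoid R] (f : Pr N → R) (k : Rest i₀) :
    ∑ e : Pr N with k.1 ∈ e.1, f e =
      f (starPair k) + ∑ e : Pr (Rest i₀) with k ∈ e.1, f (innerPair e) := by
  rw [Finset.sum_filter, sum_pairs (i₀ := i₀), Finset.sum_filter]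
  congr 1
  · rw [Finset.sum_eq_single k]
    · rw [if_pos (show k.1 ∈ (starPair k).1 from Sym2.mem_mk_right _ _)]
    · intro b _ hb
      rw [if_neg]
      intro h
      rcases Sym2.mem_iff.1 h with h | h
      · exact k.2 h
      · exact hb (Subtype.ext h).symm
    · simp
  · simp only [mem_innerPair]

open scoped Classical in
lemma sum_pairs_mem_self {R : Type*} [AddCommMonoid R] (f : Pr N → R) :
    ∑ e : Pr N with i₀ ∈ e.1, f e = ∑ k : Rest i₀, f (starPair k) := by
  rw [Finset.sum_filter, sum_pairs (i₀ := i₀)]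
  have h1 : ∀ k : Rest i₀, i₀ ∈ (starPair k).1 := fun k => Sym2.mem_mk_left _ _
  simp [h1, not_mem_innerPair]

-- The cut formula for the full set, where no pair is cut.
open scoped Classical in
lemma sum_sum_mem {M : Type} [Fintype M] {R : Type} [CommRing R] (f : Pr M → R) :
    ∑ k, ∑ e : Pr M with k ∈ e.1, f e = 2 * ∑ e, f e := by
  have h := mandelstam_eq_sum_cut (Δ := fun k => ∑ e : Pr M with k ∈ e.1, f e) (τ := f)
    (fun _ => rfl) Set.univ
  rw [mandelstam_univ] at h
  rw [← sub_eq_zero, h]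
  simp

-- The constraints at `k ≠ i₀` determine `τ_{i₀k}`; given these, the one at `i₀` only fixes the
-- total of the inner variables. So the integration domain is a hyperplane in the space of inner
-- pairs.
open scoped Classical in
lemma canonical_iff {R : Type} [CommRing R] {Δ : N → R} {τ : Pr N → R} : Canonical Δ τ ↔
    (∀ k : Rest i₀, τ (starPair k) + ∑ e with k ∈ e.1, τ (innerPair e) = Δ k.1) ∧
      ∑ k : Rest i₀, Δ k.1 - 2 * ∑ e : Pr (Rest i₀), τ (innerPair e) = Δ i₀ := by
  have key : (∀ k : Rest i₀, τ (starPair k) + ∑ e with k ∈ e.1, τ (innerPair e) = Δ k.1) →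
      ∑ k : Rest i₀, Δ k.1 - 2 * ∑ e : Pr (Rest i₀), τ (innerPair e) =
        ∑ e : Pr N with i₀ ∈ e.1, τ e := by
    intro h
    have h3 : ∑ k : Rest i₀, ∑ e with k ∈ e.1, τ (innerPair e) =
        2 * ∑ e : Pr (Rest i₀), τ (innerPair e) := by
      convert sum_sum_mem _
    rw [sum_pairs_mem_self]
    simp only [← h, Finset.sum_add_distrib, h3]
    ring
  constructor
  · intro h
    have h1 : ∀ k : Rest i₀, τ (starPair k) + ∑ e with k ∈ e.1, τ (innerPair e) = Δ k.1 :=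
      fun k => by rw [← h k.1, sum_pairs_mem]
    exact ⟨h1, by rw [key h1, h]⟩
  · rintro ⟨h1, h2⟩ i
    by_cases hi : i = i₀
    · subst hi
      rw [← h2, key h1]
    · rw [← h1 ⟨i, hi⟩, ← sum_pairs_mem]

variable (Δ : N → ℂ) (e₀ : Pr (Rest i₀)) (z : Rest e₀ → ℂ)

lemma solve_innerPair (e : Pr (Rest i₀)) : solve Δ e₀ z (innerPair e) = solveInner Δ e₀ z e := by
  rw [solve, dif_neg (not_mem_innerPair e)]
  congr 1
  apply Pr.map_injective (Function.Embedding.subtype _)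
  exact innerPair_restrict _ _

open scoped Classical in
lemma solve_starPair (k : Rest i₀) : solve Δ e₀ z (starPair k) =
    Δ k.1 - ∑ e : Pr (Rest i₀) with k ∈ e.1, solveInner Δ e₀ z e := by
  have h : i₀ ∈ (starPair k).1 := Sym2.mem_mk_left _ _
  rw [solve, dif_pos h]
  simp only [other_starPair]
  congr 1
  refine Finset.sum_congr ?_ fun _ _ => rfl
  ext e
  simp only [Finset.mem_filter, Finset.mem_univ, true_and]
  exact mem_innerPair

lemma sum_solveInner :
    ∑ e, solveInner Δ e₀ z e = (∑ k : Rest i₀, Δ k.1 - Δ i₀) / 2 := by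
  rw [sum_eq_add_sum_rest e₀]
  have : ∀ e : Rest e₀, solveInner Δ e₀ z e.1 = z e := fun e => by simp [solveInner, e.2]
  simp only [this]
  simp [solveInner]

lemma canonical_solve : Canonical Δ (solve Δ e₀ z) := by
  classical
  refine (canonical_iff (i₀ := i₀)).2 ⟨fun k => ?_, ?_⟩
  · simp only [solve_innerPair]
    rw [solve_starPair]
    ring
  · simp only [solve_innerPair, sum_solveInner]
    ring

variable {Δ} {ρ : Pr N → ℝ}

lemma sum_inner_eq (hρ : Canonical (fun i => (Δ i).re) ρ) :
    ∑ e : Pr (Rest i₀), ρ (innerPair e) = ((∑ k : Rest i₀, Δ k.1 - Δ i₀) / 2).re := by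
  have := ((canonical_iff (i₀ := i₀)).1 hρ).2
  simp only [div_ofNat_re, sub_re, re_sum]
  linarith

/-- The constraints on `ρ` make the solved variable run over `Re = ρ` too. The imaginary parts fill
a hyperplane whose total need not vanish, since the dimensions are complex. -/
lemma solveInner_line (hρ : Canonical (fun i => (Δ i).re) ρ) (y : Rest e₀ → ℝ)
    (e : Pr (Rest i₀)) :
    solveInner Δ e₀ (line 1 (insertionBase e₀ ρ) y) e =
      ρ (innerPair e) + fillSum ((∑ k : Rest i₀, Δ k.1 - Δ i₀) / 2).im y e * I := by
  have hne : ∀ f : Rest e₀, line 1 (insertionBase e₀ ρ) y f = ρ (innerPair f.1) + y f * I := by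
    intro f
    simp [line, insertionBase]
  by_cases h : e = e₀
  · subst h
    have h1 := sum_inner_eq (i₀ := i₀) hρ
    rw [sum_eq_add_sum_rest e] at h1
    simp only [solveInner, fillSum, dif_pos, hne, Finset.sum_add_distrib, ← Finset.sum_mul]
    rw [← Complex.re_add_im ((∑ k : Rest i₀, Δ k.1 - Δ i₀) / 2), ← h1]
    simp only [add_im, ofReal_im, mul_im, ofReal_re, I_re, I_im]
    push_cast
    ring
  · simp only [solveInner, fillSum, dif_neg h, hne]

lemma re_solve_line (hρ : Canonical (fun i => (Δ i).re) ρ) (y : Rest e₀ → ℝ) (e : Pr N) :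
    (solve Δ e₀ (line 1 (insertionBase e₀ ρ) y) e).re = ρ e := by
  classical
  obtain ⟨k | e, rfl⟩ := (bijective_pairs (i₀ := i₀)).2 e
  · rw [Sum.elim_inl, solve_starPair]
    simp only [solveInner_line e₀ hρ, sub_re, re_sum]
    have := ((canonical_iff (i₀ := i₀)).1 hρ).1 k
    simp
    linarith
  · rw [Sum.elim_inr, solve_innerPair, solveInner_line e₀ hρ]
    simp

end Solve

end Witten

namespace Witten

open Complex MeasureTheory

/-! ### The insertion formula for a general integrand. -/

section TreeFormula

variable {V N A₀ : Type} [Fintype V] [Fintype N] [Fintype A₀] {G : SimpleGraph V} {att : N → V}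
  {i₀ : N} {R : Type} [CommRing R]

open scoped Classical in
/-- The total dimension of the points other than `i₀` that are attached to the branch at `a`. -/
noncomputable def branchDim (G : SimpleGraph V) (att : N → V) (i₀ : N) (Δ : N → R) (a : V) : R :=
  ∑ k : Rest i₀ with att k.1 ∈ branch G (att i₀) a, Δ k.1

omit [Fintype V] [Fintype N] in
lemma oldCut_eq (a : V) : oldCut G att i₀ a =
    Function.Embedding.subtype _ '' {k : Rest i₀ | att k.1 ∈ branch G (att i₀) a} := by
  ext k
  simp [oldCut, and_comm]

omit [Fintype V] [Fintype N] [Fintype A₀] in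
lemma newCut_eq (a : V) : newCut G att i₀ A₀ a =
    Function.Embedding.inl '' {k : Rest i₀ | att k.1 ∈ branch G (att i₀) a} := by
  ext x
  rcases x with x | x <;> simp [newCut, insertAtt]

open scoped Classical in
lemma mandelstam_branch (hG : G.IsTree) (Δ : N → R) (t : Pr (Rest i₀) → R) (a : V) :
    mandelstam (fun k : Rest i₀ => Δ k.1) t {k : Rest i₀ | att k.1 ∈ branch G (att i₀) a} =
      branchDim G att i₀ Δ a - 2 * ∑ e : Pr (Rest i₀) with meet G att e ∈ branch G (att i₀) a, t e := by
  unfold mandelstam branchDim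
  congr 2
  refine Finset.sum_congr ?_ fun _ _ => rfl
  ext e
  simp only [Finset.mem_filter, Finset.mem_univ, true_and]
  exact (meet_mem_branch_iff hG a e).symm

open scoped Classical in
lemma mandelstam_oldCut (hG : G.IsTree) (Δ : N → R) (τ : Pr N → R) (a : V) :
    mandelstam Δ τ (oldCut G att i₀ a) = branchDim G att i₀ Δ a -
      2 * ∑ e : Pr (Rest i₀) with meet G att e ∈ branch G (att i₀) a, τ (innerPair e) := by
  rw [oldCut_eq, mandelstam_image]
  exact mandelstam_branch hG Δ _ a

open scoped Classical in
lemma mandelstam_newCut (hG : G.IsTree) (Δ : N → R) (Δ' : A₀ → R)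
    (δ : Pr (Rest i₀ ⊕ A₀) → R) (a : V) :
    mandelstam (insertDim Δ Δ') δ (newCut G att i₀ A₀ a) = branchDim G att i₀ Δ a -
      2 * ∑ e : Pr (Rest i₀) with meet G att e ∈ branch G (att i₀) a, δ (e.map .inl) := by
  rw [newCut_eq, mandelstam_image]
  exact mandelstam_branch hG Δ _ a

omit [Fintype V] in
open scoped Classical in
lemma vertexDim_eq (Δ : N → ℂ) (a : V) :
    vertexDim att Δ i₀ a = ∑ k : Rest i₀ with att k.1 = a, Δ k.1 := by
  unfold vertexDim
  symm
  refine Finset.sum_nbij Subtype.val ?_ Subtype.val_injective.injOn ?_ fun _ _ => rfl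
  · intro k hk
    simpa [k.2] using hk
  · intro k hk
    simpa [and_comm] using hk

-- Taking differences with the children turns branch totals into vertex totals, both for dimensions
-- and for Mellin variables. This is how block sums become the arguments of the Beta functions.
open scoped Classical in
lemma vertex_sum_eq (hG : G.IsTree) (Δ : N → ℂ) (t : Pr (Rest i₀) → ℂ) (W : V → ℂ)
    (hW : ∀ a, W a = branchDim G att i₀ Δ a -
      2 * ∑ e : Pr (Rest i₀) with meet G att e ∈ branch G (att i₀) a, t e) (a : V) :
    (vertexDim att Δ i₀ a - W a + ∑ b with b ∈ children G (att i₀) a, W b) / 2 =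
      ∑ e : Pr (Rest i₀) with meet G att e = a, t e := by
  have hD : ∀ a, branchDim G att i₀ Δ a =
      ∑ v with v ∈ branch G (att i₀) a, vertexDim att Δ i₀ v := by
    intro a
    unfold branchDim
    rw [sum_filter_mem_eq (fun k : Rest i₀ => att k.1)]
    simp only [vertexDim_eq]
  have hT := fun a => sum_filter_mem_eq (meet G att) t (branch G (att i₀) a)
  have h1 := sum_branch_eq hG (r := att i₀) (vertexDim att Δ i₀) a
  have h2 := sum_branch_eq hG (r := att i₀) (fun v => ∑ e : Pr (Rest i₀) with meet G att e = v, t e) a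
  simp only [hW, Finset.sum_sub_distrib, ← Finset.mul_sum]
  simp only [← hD, ← hT] at h1 h2
  rw [h1, h2]
  ring

lemma integral_comp_two_smul_sub {ι : Type} [Fintype ι] (H : (ι → ℝ) → ℂ) (d : ι → ℝ)
    (h : Integrable fun w : ι → ℝ => H ((2 : ℝ) • w - d)) : Integrable H ∧
    ∫ w : ι → ℝ, H ((2 : ℝ) • w - d) = ((2 : ℂ) ^ Fintype.card ι)⁻¹ * ∫ y, H y := by
  constructor
  · have h1 := (integrable_comp_smul_iff volume
      (fun w => H (w - d)) (two_ne_zero (α := ℝ))).1 h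
    simpa using h1.comp_add_right d
  · have h1 := Measure.integral_comp_smul (volume : Measure (ι → ℝ)) (fun w => H (w - d)) 2
    rw [integral_sub_right_eq_self (fun w => H w) d] at h1
    rw [h1, Module.finrank_fintype_fun_eq_card, abs_of_pos (by positivity), real_smul]
    push_cast
    rfl

/-- The insertion integral as an integral over the Mandelstam variables, for a function `M₀` which
on the contour depends on the Mandelstam variables only. -/
theorem vertexInsertion_eq (hG : G.IsTree) (hval : ∀ v, 3 ≤ valency G att v)
    (h : ℝ) (c : ℂ) (Δ : N → ℂ) (hc : Δ i₀ = h - c) (Δ' : A₀ → ℂ)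
    (δ : Pr (Rest i₀ ⊕ A₀) → ℂ) (hδ : Canonical (insertDim Δ Δ') δ) (e₀ : Pr (Rest i₀))
    (ρ : Pr N → ℝ) (hρ : Canonical (fun i => (Δ i).re) ρ)
    (hpos : ∀ e : Pr (Rest i₀), 0 < ρ (innerPair e) ∧ ρ (innerPair e) < (δ (e.map .inl)).re)
    (M₀ : (Pr N → ℂ) → ℂ) (m₀ : (Rest (att i₀) → ℂ) → ℂ)
    (hM : ∀ τ, Canonical Δ τ → (∀ e, (τ e).re = ρ e) →
      M₀ τ = m₀ fun a => mandelstam Δ τ (oldCut G att i₀ a.1))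
    (hconv : MellinConverges 1 (insertionBase e₀ ρ) (insertionIntegrand h c Δ Δ' e₀ M₀ δ)) :
    MellinConverges (-1) (fun a : Rest (att i₀) => mandelstam (fun i => (Δ i).re) ρ
        (oldCut G att i₀ a.1)) (fun x => m₀ x * treeKernel h c G att Δ i₀ (∑ i, Δ' i) x
          fun a => mandelstam (insertDim Δ Δ') δ (newCut G att i₀ A₀ a)) ∧
      vertexInsertion h c Δ Δ' e₀ ρ M₀ δ = 1 / (-2) ^ Fintype.card (Rest (att i₀)) *
        mellinIntegral (-1) (fun a : Rest (att i₀) => mandelstam (fun i => (Δ i).re) ρ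
          (oldCut G att i₀ a.1)) (fun x => m₀ x * treeKernel h c G att Δ i₀ (∑ i, Δ' i) x
            fun a => mandelstam (insertDim Δ Δ') δ (newCut G att i₀ A₀ a)) := by
  classical
  set ξ : Rest (att i₀) → ℝ := fun a =>
    mandelstam (fun i => (Δ i).re) ρ (oldCut G att i₀ a.1) with hξ
  set s : V → ℂ := fun a => mandelstam (insertDim Δ Δ') δ (newCut G att i₀ A₀ a) with hs
  choose rep hrep using exists_meet_eq (i₀ := i₀) hG hval
  let kids : V → Finset V := fun a => Finset.univ.filter fun b => b ∈ children G (att i₀) a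
  have hkids : ∀ (f : V → ℝ) a, ∑ v with v ∈ branch G (att i₀) a, f v =
      f a + ∑ b ∈ kids a, ∑ v with v ∈ branch G (att i₀) b, f v :=
    fun f a => sum_branch_eq hG f a
  have hroot : branch G (att i₀) (att i₀) = Set.univ := branch_root
  set Z : ℂ := (∑ k : Rest i₀, Δ k.1 - Δ i₀) / 2 with hZ
  let D : V → ℂ := branchDim G att i₀ Δ
  let H : (Rest (att i₀) → ℝ) → ℂ := fun y =>
    (fun x => m₀ x * treeKernel h c G att Δ i₀ (∑ i, Δ' i) x s) (line (-1) ξ y)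
  -- If `w` are the branch sums of the imaginary parts, then `Im Ξ = Im D - 2 w`; on the downward
  -- line the parameter is its negative.
  let η : (Rest (att i₀) → ℝ) → Rest (att i₀) → ℝ := fun w => (2 : ℝ) • w - fun a => (D a.1).im
  let F : (Rest (att i₀) → ℝ) → ℂ := fun w =>
    m₀ (line (-1) ξ (η w)) * K₂ h c (∑ i, Δ' i) (s (att i₀))
  have hDre : ∀ a, branchDim G att i₀ (fun i => (Δ i).re) a = (D a).re := by
    intro a
    simp only [D, branchDim, re_sum]
  -- the Mandelstam variables on the contour
  have hline : ∀ (w : Rest (att i₀) → ℝ) (a : Rest (att i₀)), line (-1) ξ (η w) a = D a.1 -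
      2 * (∑ e : Pr (Rest i₀) with meet G att e ∈ branch G (att i₀) a.1, (ρ (innerPair e) : ℂ) + w a * I) := by
    intro w a
    have h1 : ξ a = (D a.1).re -
        2 * ∑ e : Pr (Rest i₀) with meet G att e ∈ branch G (att i₀) a.1, ρ (innerPair e) := by
      rw [hξ]
      simp only [mandelstam_oldCut hG, hDre]
    simp only [line, η, h1, Pi.sub_apply, Pi.smul_apply, smul_eq_mul]
    nth_rewrite 3 [← Complex.re_add_im (D a.1)]
    push_cast
    ring
  have hbr : ∀ (y : Rest e₀ → ℝ) (a : V),
      ∑ e : Pr (Rest i₀) with meet G att e ∈ branch G (att i₀) a,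
        solve Δ e₀ (line 1 (insertionBase e₀ ρ) y) (innerPair e) =
      ∑ e : Pr (Rest i₀) with meet G att e ∈ branch G (att i₀) a, (ρ (innerPair e) : ℂ) +
        branchSum (meet G att) (branch G (att i₀)) (fillSum Z.im y) a * I := by
    intro y a
    simp only [solve_innerPair, solveInner_line e₀ hρ, Finset.sum_add_distrib, branchSum,
      ofReal_sum, Finset.sum_mul, hZ]
  -- The old points and `A₀` are complementary in the new diagram, so they have equal Mandelstam
  -- variables.
  have hsroot : s (att i₀) = mandelstam (insertDim Δ Δ') δ (Set.range Sum.inr) := by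
    rw [← mandelstam_compl hδ, hs]
    simp only [newCut_eq, hroot]
    congr 1
    ext x
    rcases x with x | x <;> simp
  have hintegrand : ∀ y : Rest e₀ → ℝ,
      insertionIntegrand h c Δ Δ' e₀ M₀ δ (line 1 (insertionBase e₀ ρ) y) =
      F (fun a => branchSum (meet G att) (branch G (att i₀)) (fillSum Z.im y) a.1) *
        ∏ e, B (ρ (innerPair e) + fillSum Z.im y e * I) (δ (e.map .inl)) := by
    intro y
    rw [insertionIntegrand, hM _ (canonical_solve Δ e₀ _) (re_solve_line e₀ hρ y), preKernel,
      ← mul_assoc]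
    congr 1
    · simp only [F]
      rw [← hsroot]
      congr 2
      ext a
      rw [mandelstam_oldCut hG, hline, hbr]
    · refine Finset.prod_congr rfl fun e _ => ?_
      rw [solve_innerPair, solveInner_line e₀ hρ]
  have hker : ∀ w : Rest (att i₀) → ℝ, F w *
      ∏ v, B (∑ e : Pr (Rest i₀) with meet G att e = v, (ρ (innerPair e) : ℂ) + (fillValue Z.im w v -
        ∑ b ∈ kids v, fillValue Z.im w b : ℝ) * I)
        (∑ e : Pr (Rest i₀) with meet G att e = v, δ (e.map .inl)) = H (η w) := by
    intro w
    simp only [H, F]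
    rw [treeKernel, mul_assoc]
    congr 2
    refine Finset.prod_congr rfl fun v _ => ?_
    have hZre := sum_inner_eq (i₀ := i₀) hρ
    -- At the root the hyperplane condition gives `D - 2 Z = Δ i₀`, which is `h - c`.
    have hX : ∀ a, extendXi (h - c) (line (-1) ξ (η w)) a = D a -
        2 * (∑ e : Pr (Rest i₀) with meet G att e ∈ branch G (att i₀) a, (ρ (innerPair e) : ℂ) +
          fillValue Z.im w a * I) := by
      intro a
      by_cases ha : a = att i₀
      · subst ha
        have h1 : ∑ e : Pr (Rest i₀), (ρ (innerPair e) : ℂ) = (Z.re : ℂ) := by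
          rw [← hZre]
          push_cast
          rfl
        simp only [extendXi, fillValue, dif_pos, hroot, Set.mem_univ, Finset.filter_true, h1,
          Complex.re_add_im, D, branchDim, hZ, ← hc]
        ring
      · simp only [extendXi, fillValue, dif_neg ha]
        exact hline w ⟨a, ha⟩
    have hS := vertex_sum_eq hG Δ (fun e => δ (e.map .inl)) s
      (fun a => mandelstam_newCut hG Δ Δ' δ a) v
    have hR := vertex_sum_eq (att := att) (i₀ := i₀) hG Δ (fun e => (ρ (innerPair e) : ℂ)) _ (fun a => rfl) v
    congr 1
    · rw [← hR]
      simp only [hX, mul_add, Finset.sum_sub_distrib, Finset.sum_add_distrib, D, kids]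
      push_cast
      simp only [← Finset.mul_sum, ← Finset.sum_mul]
      ring
    · exact hS.symm
  have hmain := integral_hyperplane_eq (β := meet G att) (rep := rep) (r := att i₀)
    (br := branch G (att i₀)) (kids := kids) hrep hkids hroot e₀ Z.im
    (fun e => ρ (innerPair e)) (fun e => δ (e.map .inl)) (fun e => (hpos e).1)
    (fun e => (hpos e).2) F
    (hconv.congr (Filter.Eventually.of_forall hintegrand))
  simp only [hker, ← hintegrand] at hmain
  obtain ⟨hint, hval⟩ := hmain
  obtain ⟨hint', hscale⟩ := integral_comp_two_smul_sub H (fun a => (D a.1).im) hint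
  refine ⟨hint', ?_⟩
  rw [vertexInsertion, mellinIntegral, mellinIntegral]
  have hpi : (Real.pi : ℂ) ≠ 0 := by exact_mod_cast Real.pi_ne_zero
  change _ = _ * (_ * ∫ y, H y)
  have e1 : (((1 : ℝ) : ℂ) / (2 * (Real.pi : ℂ))) = 1 / (2 * Real.pi : ℂ) := by push_cast; rfl
  rw [e1, hval, hscale, ← mul_assoc, ← mul_assoc]
  congr 1
  -- Per variable: `(1 / 2π) (1 / 2) = (1 / (-2)) (-1 / 2π)`, the two signs being those of
  -- orientation and prefactor.
  rw [← one_div_pow, ← mul_pow, ← inv_pow, ← mul_pow]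
  congr 1
  push_cast
  field_simp

end TreeFormula

end Witten

namespace Witten

open Complex MeasureTheory

/-! ### Measurability, absolute convergence and polynomial growth. -/

section Bounds

variable {N A₀ : Type} [Fintype N] [Fintype A₀] {i₀ : N}

lemma measurable_solveInner (Δ : N → ℂ) (e₀ : Pr (Rest i₀)) (e : Pr (Rest i₀)) :
    Measurable fun z => solveInner Δ e₀ z e := by
  by_cases h : e = e₀
  · simp only [solveInner, dif_pos h]
    fun_prop
  · simp only [solveInner, dif_neg h]
    fun_prop

lemma measurable_solve (Δ : N → ℂ) (e₀ : Pr (Rest i₀)) : Measurable (solve Δ e₀) := by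
  classical
  refine measurable_pi_iff.2 fun e => ?_
  obtain ⟨k | e, rfl⟩ := (bijective_pairs (i₀ := i₀)).2 e
  · simp only [Sum.elim_inl, solve_starPair]
    exact measurable_const.sub (Finset.measurable_sum _ fun f _ => measurable_solveInner Δ e₀ f)
  · simp only [Sum.elim_inr, solve_innerPair]
    exact measurable_solveInner Δ e₀ e

lemma measurable_line {ι : Type} [Fintype ι] (ε : ℝ) (x : ι → ℝ) : Measurable (line ε x) := by
  unfold line
  fun_prop

lemma measurable_mandelstam (Δ : N → ℂ) (S : Set N) :
    Measurable fun τ : Pr N → ℂ => mandelstam Δ τ S := by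
  unfold mandelstam
  fun_prop

lemma measurable_preKernel (h : ℝ) (c : ℂ) (Δ : N → ℂ) (Δ' : A₀ → ℂ) :
    Measurable fun p : (Pr (Rest i₀ ⊕ A₀) → ℂ) × (Pr N → ℂ) => preKernel h c Δ Δ' p.2 p.1 := by
  unfold preKernel
  refine ((measurable_K₂ h c _).comp ((measurable_mandelstam _ _).comp measurable_fst)).mul ?_
  exact Finset.measurable_prod _ fun e _ => measurable_B (by fun_prop) (by fun_prop)

lemma measurable_const_mul_integral {α β γ : Type} [MeasurableSpace α] [MeasureSpace β]
    [SFinite (volume : Measure β)] [MeasurableSpace γ] (C : ℂ) {f : γ → ℂ} {k : γ → α → ℂ}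
    {z : β → γ} (hf : Measurable f) (hk : Measurable fun p : α × γ => k p.2 p.1)
    (hz : Measurable z) : Measurable fun a => C * ∫ y, f (z y) * k (z y) a := by
  have h1 : Measurable fun p : α × β => f (z p.2) * k (z p.2) p.1 :=
    (hf.comp (hz.comp measurable_snd)).mul
      (hk.comp (measurable_fst.prodMk (hz.comp measurable_snd)))
  exact measurable_const.mul h1.stronglyMeasurable.integral_prod_right.measurable

lemma measurable_vertexInsertion (h : ℝ) (c : ℂ) (Δ : N → ℂ) (Δ' : A₀ → ℂ) (e₀ : Pr (Rest i₀))
    (ρ : Pr N → ℝ) {M₀ : (Pr N → ℂ) → ℂ} (hM : Measurable M₀) :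
    Measurable (vertexInsertion h c Δ Δ' e₀ ρ M₀) :=
  measurable_const_mul_integral (((1 : ℝ) / (2 * Real.pi)) ^ Fintype.card (Rest e₀)) hM
    (measurable_preKernel h c Δ Δ')
    ((measurable_solve Δ e₀).comp (measurable_line 1 (insertionBase e₀ ρ)))

/-- `M` grows at most polynomially at fixed real parts `σ` of its variables. -/
def PolynomialGrowth (σ : Pr N → ℝ) (M : (Pr N → ℂ) → ℂ) : Prop :=
  ∃ (C : ℝ) (k : ℕ), 0 ≤ C ∧ ∀ τ : Pr N → ℂ, (∀ e, (τ e).re = σ e) → ‖M τ‖ ≤ C * (1 + ‖τ‖) ^ k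

lemma prod_eq_mul_prod_rest {P : Type} {R : Type*} [Fintype P] [CommMonoid R] (e₀ : P) (f : P → R) :
    ∏ e, f e = f e₀ * ∏ e : Rest e₀, f e.1 := by
  classical
  rw [← Finset.mul_prod_erase _ _ (Finset.mem_univ e₀)]
  congr 1
  exact Finset.prod_subtype _ (by simp) f

/-- The product form on the right is what the decay of the separate Beta functions can cancel. -/
lemma norm_solve_le (Δ : N → ℂ) (e₀ : Pr (Rest i₀)) (z : Rest e₀ → ℂ) :
    1 + ‖solve Δ e₀ z‖ ≤ (1 + ∑ k, ‖Δ k‖ + Fintype.card (Pr (Rest i₀))) *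
      ∏ e, (1 + ‖solveInner Δ e₀ z e‖) := by
  classical
  set a : Pr (Rest i₀) → ℝ := fun e => 1 + ‖solveInner Δ e₀ z e‖ with ha
  have ha1 : ∀ e, 1 ≤ a e := fun e => by simp [ha]
  have hA1 : 1 ≤ ∏ e, a e := by
    simpa using Finset.prod_le_prod (s := Finset.univ) (fun _ _ => zero_le_one) fun e _ => ha1 e
  have hle : ∀ e, ‖solveInner Δ e₀ z e‖ ≤ ∏ e, a e := by
    intro e
    have h1 : a e ≤ ∏ e, a e := by
      simpa using Finset.prod_le_prod_of_subset_of_one_le (Finset.subset_univ {e})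
        (fun e _ => zero_le_one.trans (ha1 e)) fun e _ _ => ha1 e
    have h2 : ‖solveInner Δ e₀ z e‖ ≤ a e := by simp [ha]
    exact h2.trans h1
  have hΔ : 0 ≤ ∑ k, ‖Δ k‖ := Finset.sum_nonneg fun _ _ => norm_nonneg _
  have hcard : (1 : ℝ) ≤ Fintype.card (Pr (Rest i₀)) := by
    exact_mod_cast Fintype.card_pos_iff.2 ⟨e₀⟩
  have key : ‖solve Δ e₀ z‖ ≤ (∑ k, ‖Δ k‖ + Fintype.card (Pr (Rest i₀))) * ∏ e, a e := by
    refine (pi_norm_le_iff_of_nonneg (by positivity)).2 fun e => ?_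
    obtain ⟨k | e, rfl⟩ := (bijective_pairs (i₀ := i₀)).2 e
    · rw [Sum.elim_inl, solve_starPair]
      refine (norm_sub_le _ _).trans ?_
      have h1 : ‖Δ k.1‖ ≤ ∑ k, ‖Δ k‖ :=
        Finset.single_le_sum (f := fun k => ‖Δ k‖) (fun _ _ => norm_nonneg _) (Finset.mem_univ _)
      have h2 : ‖∑ e : Pr (Rest i₀) with k ∈ e.1, solveInner Δ e₀ z e‖ ≤
          Fintype.card (Pr (Rest i₀)) * ∏ e, a e := by
        refine (norm_sum_le _ _).trans ((Finset.sum_le_card_nsmul _ _ _ fun e _ => hle e).trans ?_)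
        rw [nsmul_eq_mul]
        gcongr
        exact Finset.card_le_univ _
      nlinarith
    · rw [Sum.elim_inr, solve_innerPair]
      have := hle e
      nlinarith
  nlinarith

/-- A bound for the integrand of vertex insertion, without the factor `K₂`. -/
lemma exists_integrand_bound (Δ : N → ℂ) (e₀ : Pr (Rest i₀)) {ρ : Pr N → ℝ}
    (hρ : Canonical (fun i => (Δ i).re) ρ) (hpos : ∀ e : Pr (Rest i₀), 0 < ρ (innerPair e))
    {M₀ : (Pr N → ℂ) → ℂ} (hM : PolynomialGrowth ρ M₀) (σ : Pr (Rest i₀) → ℝ)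
    (hσ : ∀ e, ρ (innerPair e) < σ e) :
    ∃ (C : ℝ) (k : ℕ) (g : (Rest e₀ → ℝ) → ℝ), 0 ≤ C ∧ (∀ y, 0 ≤ g y) ∧ Integrable g ∧
      ∀ (δ : Pr (Rest i₀ ⊕ A₀) → ℂ), (∀ e : Pr (Rest i₀), (δ (e.map .inl)).re = σ e) →
      ∀ y, ‖M₀ (solve Δ e₀ (line 1 (insertionBase e₀ ρ) y)) *
        ∏ e : Pr (Rest i₀), B (solve Δ e₀ (line 1 (insertionBase e₀ ρ) y) (innerPair e))
          (δ (e.map .inl))‖ ≤ C * (1 + ‖δ‖) ^ k * g y := by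
  obtain ⟨C₀, k₀, hC₀, hb₀⟩ := hM
  -- `k₀` powers cancel the growth of `M₀`; the other two make the rest integrable.
  choose C hC hb using fun e => exists_norm_B_le_pow (k₀ + 2) (ρ (innerPair e)) (σ e) (hpos e)
    (hσ e)
  set L : ℝ := 1 + ∑ k, ‖Δ k‖ + Fintype.card (Pr (Rest i₀)) with hL
  have hL0 : 0 ≤ L := by positivity
  let t : (Rest e₀ → ℝ) → Pr (Rest i₀) → ℂ := fun y e =>
    solveInner Δ e₀ (line 1 (insertionBase e₀ ρ) y) e
  have hCprod : 0 ≤ ∏ e, C e := Finset.prod_nonneg fun e _ => hC e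
  refine ⟨C₀ * L ^ k₀ * ∏ e, C e, (k₀ + 2) * Fintype.card (Pr (Rest i₀)),
    fun y => ∏ e : Rest e₀, ((1 + ‖(ρ (innerPair e.1) : ℂ) + y e * I‖) ^ 2)⁻¹, by positivity,
    fun y => Finset.prod_nonneg fun e _ => by positivity,
    Integrable.fintype_prod (f := fun (e : Rest e₀) (q : ℝ) =>
      ((1 + ‖(ρ (innerPair e.1) : ℂ) + q * I‖) ^ 2)⁻¹)
      fun e => integrable_inv_one_add_norm_sq _, ?_⟩
  intro δ hδ y
  set A : ℝ := ∏ e, (1 + ‖t y e‖) with hA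
  have hA0 : 0 < A := Finset.prod_pos fun e _ => by positivity
  have h1 : ‖M₀ (solve Δ e₀ (line 1 (insertionBase e₀ ρ) y))‖ ≤ C₀ * (L * A) ^ k₀ := by
    refine (hb₀ _ (re_solve_line e₀ hρ y)).trans ?_
    gcongr
    exact norm_solve_le Δ e₀ _
  have h2 : ‖∏ e : Pr (Rest i₀), B (solve Δ e₀ (line 1 (insertionBase e₀ ρ) y) (innerPair e))
      (δ (e.map .inl))‖ ≤ ∏ e, (C e * ((1 + ‖δ‖) / (1 + ‖t y e‖)) ^ (k₀ + 2)) := by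
    rw [norm_prod]
    refine Finset.prod_le_prod (fun _ _ => norm_nonneg _) fun e _ => ?_
    rw [solve_innerPair]
    refine (hb e _ _ ?_ (hδ e)).trans ?_
    · rw [← solve_innerPair, re_solve_line e₀ hρ]
    · have := hC e
      gcongr
      exact norm_le_pi_norm δ _
  have h3 : ∏ e, (C e * ((1 + ‖δ‖) / (1 + ‖t y e‖)) ^ (k₀ + 2)) =
      (∏ e, C e) * (1 + ‖δ‖) ^ ((k₀ + 2) * Fintype.card (Pr (Rest i₀))) * (A ^ (k₀ + 2))⁻¹ := by
    rw [Finset.prod_mul_distrib, Finset.prod_pow, Finset.prod_div_distrib, Finset.prod_const,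
      Finset.card_univ, div_pow, ← pow_mul, mul_comm (Fintype.card _), ← hA]
    ring
  -- The factor of the dependent variable `e₀` is at most 1 and is dropped, leaving a product of
  -- functions of one variable each.
  have h4 : (A ^ 2)⁻¹ ≤ ∏ e : Rest e₀, ((1 + ‖(ρ (innerPair e.1) : ℂ) + y e * I‖) ^ 2)⁻¹ := by
    have h5 : ∀ e : Rest e₀, t y e.1 = (ρ (innerPair e.1) : ℂ) + y e * I := by
      intro e
      simp only [t]
      rw [solveInner_line e₀ hρ, fillSum_of_ne]
    have h6 : (A ^ 2)⁻¹ = ∏ e, ((1 + ‖t y e‖) ^ 2)⁻¹ := by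
      rw [Finset.prod_inv_distrib, Finset.prod_pow]
    have h7 : ∏ e, ((1 + ‖t y e‖) ^ 2)⁻¹ = ((1 + ‖t y e₀‖) ^ 2)⁻¹ *
        ∏ e : Rest e₀, ((1 + ‖t y e.1‖) ^ 2)⁻¹ :=
      prod_eq_mul_prod_rest e₀ (fun e => ((1 + ‖t y e‖) ^ 2)⁻¹)
    rw [h6, h7]
    simp only [h5]
    refine mul_le_of_le_one_left (Finset.prod_nonneg fun _ _ => by positivity) ?_
    refine inv_le_one_of_one_le₀ ?_
    exact one_le_pow₀ (by simp)
  rw [norm_mul]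
  calc _ ≤ (C₀ * (L * A) ^ k₀) * ((∏ e, C e) *
        (1 + ‖δ‖) ^ ((k₀ + 2) * Fintype.card (Pr (Rest i₀))) * (A ^ (k₀ + 2))⁻¹) := by
        rw [← h3]
        gcongr
    _ = C₀ * L ^ k₀ * (∏ e, C e) * (1 + ‖δ‖) ^ ((k₀ + 2) * Fintype.card (Pr (Rest i₀))) *
        (A ^ 2)⁻¹ := by
        rw [mul_pow, pow_add]
        field_simp
    _ ≤ _ := by gcongr

lemma mellinConverges_insertion (h : ℝ) (c : ℂ) (Δ : N → ℂ) (Δ' : A₀ → ℂ) (e₀ : Pr (Rest i₀))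
    {ρ : Pr N → ℝ} (hρ : Canonical (fun i => (Δ i).re) ρ)
    (hpos : ∀ e : Pr (Rest i₀), 0 < ρ (innerPair e)) {M₀ : (Pr N → ℂ) → ℂ} (hmeas : Measurable M₀)
    (hM : PolynomialGrowth ρ M₀) (δ : Pr (Rest i₀ ⊕ A₀) → ℂ)
    (hδ : ∀ e : Pr (Rest i₀), ρ (innerPair e) < (δ (e.map .inl)).re) :
    MellinConverges 1 (insertionBase e₀ ρ) (insertionIntegrand h c Δ Δ' e₀ M₀ δ) := by
  obtain ⟨C, k, g, hC, hg, hgi, hb⟩ := exists_integrand_bound (A₀ := A₀) Δ e₀ hρ hpos hM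
    (fun e => (δ (e.map .inl)).re) hδ
  have hz : Measurable fun y : Rest e₀ → ℝ => solve Δ e₀ (line 1 (insertionBase e₀ ρ) y) :=
    (measurable_solve Δ e₀).comp (measurable_line 1 _)
  refine Integrable.mono' (hgi.const_mul (‖K₂ h c (∑ i, Δ' i)
    (mandelstam (insertDim Δ Δ') δ (Set.range Sum.inr))‖ * (C * (1 + ‖δ‖) ^ k))) ?_ ?_
  · unfold insertionIntegrand
    exact ((hmeas.comp hz).mul ((measurable_preKernel h c Δ Δ').comp
      (measurable_const.prodMk hz))).aestronglyMeasurable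
  · refine Filter.Eventually.of_forall fun y => ?_
    rw [insertionIntegrand, preKernel, mul_left_comm, norm_mul, mul_assoc]
    exact mul_le_mul_of_nonneg_left (hb δ (fun _ => rfl) y) (norm_nonneg _)

lemma norm_mandelstam_le (Δ : N → ℂ) (τ : Pr N → ℂ) (S : Set N) :
    1 + ‖mandelstam Δ τ S‖ ≤ (1 + ∑ i, ‖Δ i‖ + 2 * Fintype.card (Pr N)) * (1 + ‖τ‖) := by
  classical
  have h1 : ∀ T : Finset N, ‖∑ i ∈ T, Δ i‖ ≤ ∑ i, ‖Δ i‖ := fun T =>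
    (norm_sum_le _ _).trans
      (Finset.sum_le_univ_sum_of_nonneg fun _ => norm_nonneg _)
  have h2 : ∀ T : Finset (Pr N), ‖∑ e ∈ T, τ e‖ ≤ Fintype.card (Pr N) * ‖τ‖ := by
    intro T
    refine (norm_sum_le _ _).trans
      ((Finset.sum_le_card_nsmul _ _ _ fun e _ => norm_le_pi_norm τ e).trans ?_)
    rw [nsmul_eq_mul]
    gcongr
    exact Finset.card_le_univ _
  unfold mandelstam
  have h3 := norm_sub_le (∑ i with i ∈ S, Δ i) (2 * ∑ e : Pr N with ∀ i ∈ e.1, i ∈ S, τ e)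
  rw [norm_mul, show ‖(2 : ℂ)‖ = 2 by simp] at h3
  have h4 := h1 (Finset.univ.filter fun i => i ∈ S)
  have h5 := h2 (Finset.univ.filter fun e : Pr N => ∀ i ∈ e.1, i ∈ S)
  have h6 : 0 ≤ ∑ i, ‖Δ i‖ := Finset.sum_nonneg fun _ _ => norm_nonneg _
  have h7 : (0 : ℝ) ≤ Fintype.card (Pr N) := by positivity
  have h8 : 0 ≤ ‖τ‖ := norm_nonneg _
  nlinarith [mul_nonneg h6 h8]

lemma re_mandelstam (Δ : N → ℂ) (τ : Pr N → ℂ) (S : Set N) : (mandelstam Δ τ S).re =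
    mandelstam (fun i => (Δ i).re) (fun e => (τ e).re) S := by
  simp [mandelstam]

/-- The dominating function in `exists_integrand_bound` involves `δ` only through a power of its
norm. Unlike for convergence at fixed `δ`, `K₂` now varies, and `hs` keeps its `s`-dependent
numerator Gamma off its poles. -/
lemma polynomialGrowth_vertexInsertion (h : ℝ) (c : ℂ) (Δ : N → ℂ) (Δ' : A₀ → ℂ)
    (e₀ : Pr (Rest i₀)) {ρ : Pr N → ℝ} (hρ : Canonical (fun i => (Δ i).re) ρ)
    (hpos : ∀ e : Pr (Rest i₀), 0 < ρ (innerPair e)) {M₀ : (Pr N → ℂ) → ℂ}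
    (hM : PolynomialGrowth ρ M₀) (σ : Pr (Rest i₀ ⊕ A₀) → ℝ)
    (hσ : ∀ e : Pr (Rest i₀), ρ (innerPair e) < σ (e.map .inl))
    (hs : mandelstam (fun x => (insertDim Δ Δ' x).re) σ (Set.range Sum.inr) < h + c.re) :
    PolynomialGrowth σ (vertexInsertion h c Δ Δ' e₀ ρ M₀) := by
  obtain ⟨C, k, g, hC, hg, hgi, hb⟩ := exists_integrand_bound (A₀ := A₀) Δ e₀ hρ hpos hM
    (fun e => σ (e.map .inl)) hσ
  obtain ⟨C', k', hC', hb'⟩ := exists_norm_K₂_le h c (∑ i, Δ' i) _ hs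
  set L : ℝ := 1 + ∑ i, ‖insertDim Δ Δ' i‖ + 2 * Fintype.card (Pr (Rest i₀ ⊕ A₀)) with hL
  have hL0 : 0 ≤ L := by positivity
  set a : ℝ := ‖(((1 : ℝ) : ℂ) / (2 * Real.pi)) ^ Fintype.card (Rest e₀)‖ with ha
  have hgint : 0 ≤ ∫ y, g y := integral_nonneg hg
  refine ⟨a * (C' * L ^ k' * C * ∫ y, g y), k' + k, by positivity, fun δ hδ => ?_⟩
  have hK : ‖K₂ h c (∑ i, Δ' i) (mandelstam (insertDim Δ Δ') δ (Set.range Sum.inr))‖ ≤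
      C' * (L * (1 + ‖δ‖)) ^ k' := by
    refine (hb' _ ?_).trans ?_
    · rw [re_mandelstam]
      simp only [hδ]
    · gcongr
      exact norm_mandelstam_le _ _ _
  rw [vertexInsertion, mellinIntegral, norm_mul, mul_assoc]
  refine mul_le_mul_of_nonneg_left ?_ (norm_nonneg _)
  have hint : ‖∫ y, insertionIntegrand h c Δ Δ' e₀ M₀ δ (line 1 (insertionBase e₀ ρ) y)‖ ≤
      ∫ y, (C' * (L * (1 + ‖δ‖)) ^ k') * (C * (1 + ‖δ‖) ^ k) * g y := by
    refine norm_integral_le_of_norm_le (hgi.const_mul _) (Filter.Eventually.of_forall fun y => ?_)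
    rw [insertionIntegrand, preKernel, mul_left_comm, norm_mul, mul_assoc (C' * _)]
    exact mul_le_mul hK (hb δ (fun e => hδ _) y) (norm_nonneg _) (by positivity)
  refine hint.trans_eq ?_
  rw [integral_const_mul, mul_pow, pow_add]
  ring

end Bounds

/-! ### Induction over the construction of tree pre-amplitudes. -/

section PreAmplitudes

open SimpleGraph

lemma isTree_and_valency_of_isTreePreAmplitude {h : ℝ} {V N : Type} [Fintype V] [Fintype N]
    {G : SimpleGraph V} {att : N → V} {Δ : N → ℂ} {U : Set (Pr N → ℝ)} {M : (Pr N → ℂ) → ℂ}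
    (hM : IsTreePreAmplitude h G att Δ U M) : G.IsTree ∧ ∀ v, 3 ≤ valency G att v := by
  induction hM with
  | contact Δ hN =>
    refine ⟨IsTree.of_subsingleton, fun v => ?_⟩
    rw [valency]
    simp only [Set.ofPred_true, Set.ncard_univ, Nat.card_eq_fintype_card]
    omega
  | insert hM i₀ c hc Δ' hA₀ e₀ ρ hρ hU hpos ih =>
    exact ⟨isTree_insertGraph ih.1 _, three_le_valency_insert ih.2 i₀ hA₀⟩

lemma measurable_of_isTreePreAmplitude {h : ℝ} {V N : Type} [Fintype V] [Fintype N]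
    {G : SimpleGraph V} {att : N → V} {Δ : N → ℂ} {U : Set (Pr N → ℝ)} {M : (Pr N → ℂ) → ℂ}
    (hM : IsTreePreAmplitude h G att Δ U M) : Measurable M := by
  induction hM with
  | contact Δ hN => exact measurable_const
  | insert hM i₀ c hc Δ' hA₀ e₀ ρ hρ hU hpos ih =>
    exact measurable_vertexInsertion h c _ Δ' e₀ ρ ih

lemma polynomialGrowth_of_isTreePreAmplitude {h : ℝ} {V N : Type} [Fintype V] [Fintype N]
    {G : SimpleGraph V} {att : N → V} {Δ : N → ℂ} {U : Set (Pr N → ℝ)} {M : (Pr N → ℂ) → ℂ}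
    (hM : IsTreePreAmplitude h G att Δ U M) : ∀ σ ∈ U, PolynomialGrowth σ M := by
  induction hM with
  | contact Δ hN =>
    exact fun σ _ => ⟨‖Gamma ((∑ i, Δ i) / 2 - h)‖, 0, norm_nonneg _, fun τ _ => by simp⟩
  | insert hM i₀ c hc Δ' hA₀ e₀ ρ hρ hU hpos ih =>
    exact fun σ hσ => polynomialGrowth_vertexInsertion h c _ Δ' e₀ hρ hpos (ih ρ hU) σ hσ.1 hσ.2

/-- On real parts in `U`, the function `M` depends on the Mandelstam variables of the propagators
only. -/
def DependsOnMandelstam {V N : Type} [Fintype N] (G : SimpleGraph V) (att : N → V) (Δ : N → ℂ)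
    (U : Set (Pr N → ℝ)) (M : (Pr N → ℂ) → ℂ) : Prop :=
  ∀ τ τ' : Pr N → ℂ, Canonical Δ τ → Canonical Δ τ' → (fun e => (τ e).re) ∈ U →
    (fun e => (τ' e).re) ∈ U →
    (∀ S, IsSide G S → mandelstam Δ τ (att ⁻¹' S) = mandelstam Δ τ' (att ⁻¹' S)) → M τ = M τ'

lemma DependsOnMandelstam.exists_eq {V N : Type} [Fintype V] [Fintype N]
    {G : SimpleGraph V} {att : N → V} {Δ : N → ℂ} {U : Set (Pr N → ℝ)} {M : (Pr N → ℂ) → ℂ}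
    (hM : DependsOnMandelstam G att Δ U M) (hG : G.IsTree) (i₀ : N) :
    ∃ m : (Rest (att i₀) → ℂ) → ℂ, ∀ τ, Canonical Δ τ → (fun e => (τ e).re) ∈ U →
      M τ = m fun a => mandelstam Δ τ (oldCut G att i₀ a.1) := by
  classical
  let Ξ : (Pr N → ℂ) → Rest (att i₀) → ℂ := fun τ a => mandelstam Δ τ (oldCut G att i₀ a.1)
  -- Any `τ` with the prescribed Mandelstam variables may be chosen; the value 0 is for unattained
  -- ones.
  let m : (Rest (att i₀) → ℂ) → ℂ := fun x =>
    if hx : ∃ τ, Canonical Δ τ ∧ (fun e => (τ e).re) ∈ U ∧ Ξ τ = x then M hx.choose else 0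
  refine ⟨m, fun τ hτ hU => ?_⟩
  have hx : ∃ τ', Canonical Δ τ' ∧ (fun e => (τ' e).re) ∈ U ∧ Ξ τ' = Ξ τ := ⟨τ, hτ, hU, rfl⟩
  change M τ = m (Ξ τ)
  simp only [m]
  rw [dif_pos hx]
  obtain ⟨h1, h2, h3⟩ := hx.choose_spec
  have hcut : ∀ S, IsSide G S → att i₀ ∉ S →
      mandelstam Δ τ (att ⁻¹' S) = mandelstam Δ hx.choose (att ⁻¹' S) := by
    intro S hS hr
    obtain ⟨a, ha, rfl⟩ := hS.eq_branch hG hr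
    have hpre : att ⁻¹' branch G (att i₀) a = oldCut G att i₀ a := by
      ext k
      simp only [Set.mem_preimage, oldCut, Set.mem_ofPred_eq]
      refine ⟨fun h => ⟨?_, h⟩, fun h => h.2⟩
      rintro rfl
      exact hr h
    rw [hpre]
    exact (congrFun h3 ⟨a, ha⟩).symm
  refine hM _ _ hτ h1 hU h2 fun S hS => ?_
  -- A side containing the root is replaced by its complement, which is a branch with the same
  -- Mandelstam variable.
  by_cases hr : att i₀ ∈ S
  · rw [← mandelstam_compl hτ, ← mandelstam_compl h1, ← Set.preimage_compl]
    exact hcut _ hS.compl (by simpa using hr)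
  · exact hcut S hS hr

/-- The induction hypothesis allows `vertexInsertion_eq` to be applied to the smaller diagram; in
the resulting formula `δ` enters only through the `s_(a)`, which are Mandelstam variables of sides
of the new tree. -/
lemma dependsOnMandelstam_of_isTreePreAmplitude {h : ℝ} {V N : Type} [Fintype V] [Fintype N]
    {G : SimpleGraph V} {att : N → V} {Δ : N → ℂ} {U : Set (Pr N → ℝ)} {M : (Pr N → ℂ) → ℂ}
    (hM : IsTreePreAmplitude h G att Δ U M) : DependsOnMandelstam G att Δ U M := by
  induction hM with
  | contact Δ hN => exact fun _ _ _ _ _ _ _ => rfl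
  | @insert V N A₀ _ _ _ G att Δ U M hM i₀ c hc Δ' hA₀ e₀ ρ hρ hU hpos ih =>
    intro δ δ' hδ hδ' hU' hU'' hcut
    obtain ⟨hG, hval⟩ := isTree_and_valency_of_isTreePreAmplitude hM
    obtain ⟨m, hm⟩ := ih.exists_eq hG i₀
    have hmeas := measurable_of_isTreePreAmplitude hM
    have hgrowth := polynomialGrowth_of_isTreePreAmplitude hM ρ hU
    have hm' : ∀ τ, Canonical Δ τ → (∀ e, (τ e).re = ρ e) →
        M τ = m fun a => mandelstam Δ τ (oldCut G att i₀ a.1) := fun τ hτ hre =>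
      hm τ hτ (by simpa only [hre] using hU)
    have key := fun (δ : Pr (Rest i₀ ⊕ A₀) → ℂ) (hδ : Canonical (insertDim Δ Δ') δ)
        (hlt : ∀ e : Pr (Rest i₀), ρ (innerPair e) < (δ (e.map .inl)).re) =>
      (vertexInsertion_eq hG hval h c Δ hc Δ' δ hδ e₀ ρ hρ (fun e => ⟨hpos e, hlt e⟩) M m hm'
        (mellinConverges_insertion h c Δ Δ' e₀ hρ hpos hmeas hgrowth δ hlt)).2
    rw [key δ hδ hU'.1, key δ' hδ' hU''.1]
    have hs : ∀ a, mandelstam (insertDim Δ Δ') δ (newCut G att i₀ A₀ a) =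
        mandelstam (insertDim Δ Δ') δ' (newCut G att i₀ A₀ a) := by
      intro a
      have hpre : insertAtt att i₀ A₀ ⁻¹' (some '' branch G (att i₀) a) =
          newCut G att i₀ A₀ a := by
        ext x
        simp [newCut, eq_comm]
      rw [← hpre]
      exact hcut _ (isSide_insertGraph_branch hG (att i₀) a)
    simp only [hs]

end PreAmplitudes

end Witten

/-! ### The insertion formula, for general integrands and for tree pre-amplitudes. -/

open Witten in
theorem mainTheorem5
    {V N A₀ : Type} [Fintype V] [Fintype N] [Fintype A₀]
    (G : SimpleGraph V) (hG : G.IsTree) (att : N → V) (hval : ∀ v, 3 ≤ valency G att v)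
    (i₀ : N) (hA₀ : 2 ≤ Fintype.card A₀)
    (h : ℝ) (c : ℂ) (Δ : N → ℂ) (hc : Δ i₀ = h - c) (Δ' : A₀ → ℂ)
    (δ : Pr (Rest i₀ ⊕ A₀) → ℂ) (hδ : Canonical (insertDim Δ Δ') δ)
    (e₀ : Pr (Rest i₀))
    (ρ : Pr N → ℝ) (hρ : Canonical (fun i => (Δ i).re) ρ)
    (hpos : ∀ e : Pr (Rest i₀), 0 < ρ (e.map (Function.Embedding.subtype _)) ∧
      ρ (e.map (Function.Embedding.subtype _)) < (δ (e.map .inl)).re) :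
    let Ξ : (Pr N → ℂ) → Rest (att i₀) → ℂ := fun τ a => mandelstam Δ τ (oldCut G att i₀ a.1)
    let ξ : Rest (att i₀) → ℝ := fun a => mandelstam (fun i => (Δ i).re) ρ (oldCut G att i₀ a.1)
    let s : V → ℂ := fun a => mandelstam (insertDim Δ Δ') δ (newCut G att i₀ A₀ a)
    let K : (Rest (att i₀) → ℂ) → ℂ := fun x => treeKernel h c G att Δ i₀ (∑ i, Δ' i) x s
    (∀ (M₀ : (Pr N → ℂ) → ℂ) (m₀ : (Rest (att i₀) → ℂ) → ℂ),
      (∀ τ, Canonical Δ τ → (∀ e, (τ e).re = ρ e) → M₀ τ = m₀ (Ξ τ)) →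
      MellinConverges 1 (insertionBase e₀ ρ) (insertionIntegrand h c Δ Δ' e₀ M₀ δ) →
      MellinConverges (-1) ξ (fun x => m₀ x * K x) ∧
      vertexInsertion h c Δ Δ' e₀ ρ M₀ δ =
        1 / (-2) ^ Fintype.card (Rest (att i₀)) * mellinIntegral (-1) ξ (fun x => m₀ x * K x)) ∧
    (∀ (U : Set (Pr N → ℝ)) (M₀ : (Pr N → ℂ) → ℂ), IsTreePreAmplitude h G att Δ U M₀ → ρ ∈ U →
      ∃ m₀ : (Rest (att i₀) → ℂ) → ℂ,
        (∀ τ, Canonical Δ τ → (fun e => (τ e).re) ∈ U → M₀ τ = m₀ (Ξ τ)) ∧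
        MellinConverges 1 (insertionBase e₀ ρ) (insertionIntegrand h c Δ Δ' e₀ M₀ δ) ∧
        MellinConverges (-1) ξ (fun x => m₀ x * K x) ∧
        vertexInsertion h c Δ Δ' e₀ ρ M₀ δ =
          1 / (-2) ^ Fintype.card (Rest (att i₀)) *
            mellinIntegral (-1) ξ (fun x => m₀ x * K x)) := by
  intro Ξ ξ s K
  refine ⟨fun M₀ m₀ hM hconv => vertexInsertion_eq hG hval h c Δ hc Δ' δ hδ e₀ ρ hρ hpos M₀ m₀ hM
    hconv, fun U M₀ hM hU => ?_⟩
  obtain ⟨m₀, hm⟩ := (dependsOnMandelstam_of_isTreePreAmplitude hM).exists_eq hG i₀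
  have hconv := mellinConverges_insertion h c Δ Δ' e₀ hρ (fun e => (hpos e).1)
    (measurable_of_isTreePreAmplitude hM) (polynomialGrowth_of_isTreePreAmplitude hM ρ hU) δ
    (fun e => (hpos e).2)
  have hm' : ∀ τ, Canonical Δ τ → (∀ e, (τ e).re = ρ e) → M₀ τ = m₀ (Ξ τ) := fun τ hτ hre =>
    hm τ hτ (by simpa only [hre] using hU)
  exact ⟨m₀, hm, hconv, vertexInsertion_eq hG hval h c Δ hc Δ' δ hδ e₀ ρ hρ hpos M₀ m₀ hm' hconv⟩
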